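/- **Setting.** Let $G=(V,E)$ be a finite simple graph without isolated vertices, $V\neq\varnothing$, and let $\alpha>1$. For $\vec v$ in the simplex $\Delta_E=\{\vec v\in\mathbb{R}^E: v_e\ge 0,\ \sum_{e}v_e=1\}$ put $$F(\vec v)_e=-v_e+\frac1{|V|}\sum_{x\in e}\frac{v_e^{\alpha}}{\sum_{e'\ni x}v_{e'}^{\alpha}},\qquad e\in E .$$ A vector $\vec v\in\Delta_E$ with $F(\vec v)=\vec 0$ is an *equilibrium* on $G$. It is *linearly stable* if all eigenvalues of the matrix of partial derivatives of $F$ at $\vec v$ have negative real part, *linearly unstable* if some eigenvalue has positive real part, and *critical* otherwise. The $(r,r)$-whisker graph ($r\ge1$) consists of one distinguished edge with $r$ leaves attached to each of its two endpoints; $((v)_r,u,(v)_r)$ denotes the vector with value $u$ on the distinguished edge and $v$ on the $2r$ leaf edges. A *symmetric whisker-forest* on $G$ is a collection $\mathbf{G}=\{G_1,\dots,G_k\}$ of pairwise vertex-disjoint connected subgraphs of $G$, with at least two vertices each, which together cover $V$, such that each $G_j$ is a star with at least one edge or an $(r_j,r_j)$-whisker graph for some $r_j\ge 1$. It *admits a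 $(G,\alpha)$-stable allocation* if there is an equilibrium $\vec v$ on $G$, linearly stable or critical, with $v_e>0$ for every edge $e$ belonging to some $G_j$ and $v_e=0$ for every other edge $e$ of $G$. **Theorem.** (1) For every integer $r\ge 1$ the equation $$(\alpha-1)\ln(2(\alpha-1))-\alpha\ln\alpha=\ln\frac{1+r}{2}$$ has exactly one solution $\alpha=\alpha(r)$ in $(1,\infty)$, and it satisfies $\left[2\left(1-\frac1{\alpha}\right)\right]^{\alpha-1}=\frac{\alpha}{2}(r+1)$. On the $(r,r)$-whisker graph the following holds. For every $\alpha>\alpha(r)$ there are exactly two equilibria of the form $((v)_r,u,(v)_r)$ with $u>0$; both have $v<u$, and exactly one of them is linearly stable. For the linearly stable one, $u=u(\alpha)$ is strictly increasing in $\alpha\in(\alpha(r),\infty)$ and $u(\alpha)\to\frac1{r+1}$ as $\alpha\to\infty$. For $1<\alpha<\alpha(r)$ there is no equilibrium of the form $((v)_r,u,(v)_r)$ with $u>0$. (2) Consequently, for every symmetric whisker graph $G$ (that is, an $(r,r)$-whisker graph for some $r\ge1$) there is $\alpha_G>1$ such that for every $\alpha>\alpha_G$ there is a linearly stable equilibrium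 on $G$; and for every finite non-empty graph $G$ and every symmetric whisker-forest $\mathbf{G}$ on $G$ there is a constant $\alpha_{\mathbf{G}}>1$ such that $\mathbf{G}$ admits a $(G,\alpha)$-stable allocation for every $\alpha>\alpha_{\mathbf{G}}$. -/

import Mathlib

open Filter Topology

noncomputable section

namespace WARM

/-! ### The reinforcement model with `W(x) = x ^ α` on a finite set `ι` of colours -/

open Classical in
/-- The vector field `F` of the model in which the subset `A` of colours is selected with
probability `p A`, and then colour `i ∈ A` is reinforced with probability proportional to
`v i ^ α`. -/
def drift {ι : Type*} [Fintype ι] (p : Finset ι → ℝ) (α : ℝ) (v : ι → ℝ) (i : ι) : ℝ :=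
  -v i + ∑ A : Finset ι with i ∈ A, p A * (v i ^ α / ∑ j ∈ A, v j ^ α)

open Classical in
/-- `drift` is the limit, as `t → ∞`, of the expression with weights `W(v i * t)`,
`W(x) = x ^ α`. -/
theorem tendsto_drift {ι : Type*} [Fintype ι] (p : Finset ι → ℝ) (α : ℝ) (v : ι → ℝ)
    (hv : ∀ j, 0 ≤ v j) (i : ι) :
    Tendsto (fun t : ℝ => -v i + ∑ A : Finset ι with i ∈ A,
      p A * ((v i * t) ^ α / ∑ j ∈ A, (v j * t) ^ α)) atTop (𝓝 (drift p α v i)) := by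
  refine tendsto_const_nhds.congr' ?_
  filter_upwards [eventually_gt_atTop (0 : ℝ)] with t ht
  have h : ∀ j, (v j * t) ^ α = v j ^ α * t ^ α := fun j => Real.mul_rpow (hv j) ht.le
  simp only [drift, h, ← Finset.sum_mul]
  congr 1
  refine Finset.sum_congr rfl fun A _ => ?_
  rw [mul_div_mul_right _ _ (Real.rpow_pos_of_pos ht α).ne']

/-- Equilibrium distributions: points of the simplex at which `F` vanishes. -/
def IsEquilibrium {ι : Type*} [Fintype ι] (p : Finset ι → ℝ) (α : ℝ) (v : ι → ℝ) : Prop :=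
  v ∈ stdSimplex ℝ ι ∧ ∀ i, drift p α v i = 0

open Classical in
/-- All partial derivatives `∂ f_i / ∂ v_k` exist at `v`, and `D` is the matrix they form. -/
def HasJacobian {ι : Type*} (f : (ι → ℝ) → ι → ℝ) (D : Matrix ι ι ℝ) (v : ι → ℝ) : Prop :=
  ∀ i k, HasDerivAt (fun x : ℝ => f (Function.update v k x) i) (D i k) (v k)

/-- `μ` is a complex eigenvalue of the real matrix `D`. -/
def IsEigenvalue {ι : Type*} [Fintype ι] (D : Matrix ι ι ℝ) (μ : ℂ) : Prop :=
  Module.End.HasEigenvalue (Matrix.mulVecLin (D.map (fun x : ℝ => (x : ℂ)))) μ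

/-- Linearly stable: all eigenvalues of the matrix of partial derivatives of `F` have negative
real part. -/
def IsLinearlyStable {ι : Type*} [Fintype ι] (p : Finset ι → ℝ) (α : ℝ) (v : ι → ℝ) : Prop :=
  IsEquilibrium p α v ∧ ∃ D : Matrix ι ι ℝ, HasJacobian (drift p α) D v ∧
    ∀ μ : ℂ, IsEigenvalue D μ → μ.re < 0

/-- Critical: neither linearly stable nor linearly unstable, i.e. no eigenvalue has positive real
part, but not all of them have negative real part. -/
def IsCritical {ι : Type*} [Fintype ι] (p : Finset ι → ℝ) (α : ℝ) (v : ι → ℝ) : Prop :=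
  IsEquilibrium p α v ∧ ∃ D : Matrix ι ι ℝ, HasJacobian (drift p α) D v ∧
    (¬ ∃ μ : ℂ, IsEigenvalue D μ ∧ 0 < μ.re) ∧ ¬ ∀ μ : ℂ, IsEigenvalue D μ → μ.re < 0

/-! ### Graphs: the colours are the edges, and a uniform vertex selects its incident edges -/

open Classical in
/-- The set of edges of `G` incident to the vertex `x`. -/
def incidentEdges {V : Type*} [Fintype V] (G : SimpleGraph V) (x : V) : Finset G.edgeSet :=
  Finset.univ.filter fun e => x ∈ (e : Sym2 V)

open Classical in
/-- The probability that the set of edges incident to a uniformly chosen vertex is `A`. -/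
def graphLaw {V : Type*} [Fintype V] (G : SimpleGraph V) (A : Finset G.edgeSet) : ℝ :=
  ((Finset.univ.filter fun x : V => incidentEdges G x = A).card : ℝ) / Fintype.card V

open Classical in
/-- The set `(𝓔_α)_G` of equilibria on the graph `G`. -/
def equilibria {V : Type*} [Fintype V] (G : SimpleGraph V) (α : ℝ) : Set (G.edgeSet → ℝ) :=
  {v | IsEquilibrium (graphLaw G) α v}

open Classical in
/-- The set `(𝓢_α)_G` of linearly stable equilibria on the graph `G`. -/
def stableEquilibria {V : Type*} [Fintype V] (G : SimpleGraph V) (α : ℝ) :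
    Set (G.edgeSet → ℝ) :=
  {v | IsLinearlyStable (graphLaw G) α v}

open Classical in
/-- The set of critical equilibria on the graph `G`. -/
def criticalEquilibria {V : Type*} [Fintype V] (G : SimpleGraph V) (α : ℝ) :
    Set (G.edgeSet → ℝ) :=
  {v | IsCritical (graphLaw G) α v}

/-! ### Star graphs and whisker graphs -/

/-- The `(r, s)`-whisker graph: an edge joining the two centres `inl false` and `inl true`,
`r` leaves attached to the first centre and `s` leaves attached to the second one. -/
def whiskerGraph (r s : ℕ) : SimpleGraph (Bool ⊕ (Fin r ⊕ Fin s)) :=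
  SimpleGraph.fromRel fun x y =>
    match x, y with
    | Sum.inl false, Sum.inl true => True
    | Sum.inl false, Sum.inr (Sum.inl _) => True
    | Sum.inl true, Sum.inr (Sum.inr _) => True
    | _, _ => False

/-- `H` is a star graph with at least one edge. -/
def IsStar {W : Type*} (H : SimpleGraph W) : Prop :=
  ∃ m : ℕ, 1 ≤ m ∧ Nonempty (completeBipartiteGraph Unit (Fin m) ≃g H)

/-- `H` is a copy of the symmetric `(r, r)`-whisker graph for some `r ≥ 1`. -/
def IsSymmetricWhisker {W : Type*} (H : SimpleGraph W) : Prop :=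
  ∃ r : ℕ, 1 ≤ r ∧ Nonempty (whiskerGraph r r ≃g H)

/-- The vector `((v)_r, u, (v)_r)`: value `u` on the edge joining the two centres and `v` on all
other edges. -/
def whiskerVector (r : ℕ) (v u : ℝ) (e : (whiskerGraph r r).edgeSet) : ℝ :=
  if (e : Sym2 (Bool ⊕ (Fin r ⊕ Fin r))) = s(Sum.inl false, Sum.inl true) then u else v

/-- The function `g(α) = (α - 1) log (2 (α - 1)) - α log α`, meant for `α > 1`. -/
def thresholdFun (α : ℝ) : ℝ :=
  (α - 1) * Real.log (2 * (α - 1)) - α * Real.log α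

/-! ### Spanning collections of connected clusters and stable allocations -/

/-- `H 0, …, H (k - 1)` are vertex-disjoint connected subgraphs of `G` with at least two vertices
each, which together cover all vertices of `G`. -/
def IsClusterCollection {V : Type*} [Fintype V] (G : SimpleGraph V) {k : ℕ}
    (H : Fin k → G.Subgraph) : Prop :=
  2 * k ≤ Fintype.card V ∧ (∀ j, (H j).Connected) ∧ (∀ j, 2 ≤ (H j).verts.ncard) ∧
    (⋃ j, (H j).verts) = Set.univ ∧
    ∀ i j, i ≠ j → Disjoint (H i).verts (H j).verts

/-- A symmetric whisker-forest on `G`: every component is a star graph or a symmetric whisker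
graph. -/
def IsSymmetricWhiskerForest {V : Type*} [Fintype V] (G : SimpleGraph V) {k : ℕ}
    (H : Fin k → G.Subgraph) : Prop :=
  IsClusterCollection G H ∧ ∀ j, IsStar (H j).coe ∨ IsSymmetricWhisker (H j).coe

/-- The collection `H` admits a `(G, α)`-stable allocation: there is a linearly stable or critical
equilibrium on `G` that is positive on the edges of the clusters and zero on all other edges. -/
def AdmitsStableAllocation {V : Type*} [Fintype V] (G : SimpleGraph V) (α : ℝ) {k : ℕ}
    (H : Fin k → G.Subgraph) : Prop :=
  ∃ v : G.edgeSet → ℝ,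
    (∀ e : G.edgeSet, (∃ j, (e : Sym2 V) ∈ (H j).edgeSet) → 0 < v e) ∧
    (∀ e : G.edgeSet, (¬ ∃ j, (e : Sym2 V) ∈ (H j).edgeSet) → v e = 0) ∧
    (v ∈ stableEquilibria G α ∨ v ∈ criticalEquilibria G α)

end WARM

end

noncomputable section

namespace WARM

/-! ### Incidence systems: a uniform `x : V` selects the set `inc x` of colours -/

section Incidence

open Classical

variable {V E : Type*}

/-! The spectrum at an equilibrium is governed by variances. For a vertex x let p_x be the law of
the edge reinforced when x is selected. Writing a perturbation as w = v·y, the Jacobian sends w to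
-v·y plus α/|V| times the sum over x of p_x (y - mean of y under p_x). Pairing with y gives a
quadratic form: the real part of an eigenvalue, plus one, is at most α times the largest quotient of
∑_x Var_x(y) by ∑_x E_x(y²). Edges of weight zero contribute only the eigenvalue -1. Hence
`re_le_of_variance_le`: stability follows once this quotient is below 1/α.

On the (r,r)-whisker graph put t = v/u and c = r + 1. The equilibrium equations collapse to c t^α -
2t + 1 = 0. The left side strictly decreases and then strictly increases, and the sign of its
minimum is that of log(c/2) - `thresholdFun α`; so there are two roots or none according to the side
of the threshold. The sharp variance constant is θ = α c t^(α-1)/2 (`whisker_variance_le`), and 2(θ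
- 1) is the derivative of the left side at t. The root on the decreasing branch is therefore stable;
at the other one θ - 1 is a positive eigenvalue with an explicit eigenvector. Since t < 1, raising α
lowers the smaller root, which decreases to 1/2; this gives the monotonicity and the limit of u =
1/(1 + 2rt).

For forests no exact spectrum is needed. A star is a whisker graph with no leaves at the second
centre, so both shapes are treated together. For large α each cluster carries a solution of its
equations with v/u at most 3/4. Edges outside the clusters get weight zero, so the clusters do not
interact. At every vertex one edge takes all the probability except at most (3/4)^α per other edge,
so all variances are small, and α (3/4)^α → 0 gives stability. -/

/-- The total weight of the colours in `inc x`. -/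
def weightSum (inc : V → Finset E) (α : ℝ) (v : E → ℝ) (x : V) : ℝ :=
  ∑ f ∈ inc x, v f ^ α

/-- The probability that `e` is reinforced when `inc x` is selected. -/
def selProb (inc : V → Finset E) (α : ℝ) (v : E → ℝ) (x : V) (e : E) : ℝ :=
  if e ∈ inc x then v e ^ α / weightSum inc α v x else 0

variable {inc : V → Finset E} {α : ℝ} {v : E → ℝ}

theorem HasJacobian.unique {ι : Type*} {f : (ι → ℝ) → ι → ℝ} {D D' : Matrix ι ι ℝ} {v : ι → ℝ}
    (h : HasJacobian f D v) (h' : HasJacobian f D' v) : D = D' := by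
  ext i k
  exact (h i k).unique (h' i k)

theorem hasDerivAt_update_rpow (hα : 1 ≤ α) (e k : E) :
    HasDerivAt (fun t : ℝ => Function.update v k t e ^ α)
      (if e = k then α * v k ^ (α - 1) else 0) (v k) := by
  by_cases h : e = k
  · subst h
    simpa using Real.hasDerivAt_rpow_const (x := v e) (p := α) (Or.inr hα)
  · simpa [h] using hasDerivAt_const (v k) (v e ^ α)

theorem weightSum_pos (hv : ∀ e, 0 ≤ v e) {x : V} {e : E} (he : e ∈ inc x) (hpos : 0 < v e) :
    0 < weightSum inc α v x :=
  Finset.sum_pos' (fun f _ => Real.rpow_nonneg (hv f) α) ⟨e, he, Real.rpow_pos_of_pos hpos α⟩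

theorem selProb_eq_zero (hα : α ≠ 0) {e : E} (he : v e = 0) (x : V) :
    selProb inc α v x e = 0 := by
  simp [selProb, he, Real.zero_rpow hα]

theorem rpow_sub_one_mul_self (hα : 1 < α) {x : ℝ} (hx : 0 ≤ x) : x ^ (α - 1) * x = x ^ α := by
  rcases hx.eq_or_lt with rfl | hx
  · rw [Real.zero_rpow (by linarith : α ≠ 0), mul_zero]
  · rw [Real.rpow_sub_one hx.ne', div_mul_cancel₀ _ hx.ne']

variable [Fintype E]

/-- The mean of `y` under `selProb inc α v x`. -/
def selMean (inc : V → Finset E) (α : ℝ) (v : E → ℝ) (x : V) (y : E → ℝ) : ℝ :=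
  ∑ f, selProb inc α v x f * y f

theorem sum_selProb {x : V} (hS : weightSum inc α v x ≠ 0) : ∑ e, selProb inc α v x e = 1 := by
  have h : ∑ e, selProb inc α v x e = ∑ e ∈ inc x, v e ^ α / weightSum inc α v x := by
    simp [selProb]
  rw [h, ← Finset.sum_div]
  exact div_self hS

/-- The Jacobian is not symmetric as a matrix, so its eigenvalues may a priori be complex. Splitting
an eigenvector into real and imaginary parts keeps the quadratic-form argument over ℝ. -/
theorem IsEigenvalue.exists_real {D : Matrix E E ℝ} {μ : ℂ} (h : IsEigenvalue D μ) :
    ∃ a b : E → ℝ, (∃ e, a e ≠ 0 ∨ b e ≠ 0) ∧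
      (∀ e, D.mulVec a e = μ.re * a e - μ.im * b e) ∧
      ∀ e, D.mulVec b e = μ.re * b e + μ.im * a e := by
  obtain ⟨w, hw⟩ := h.exists_hasEigenvector
  have h1 := hw.apply_eq_smul
  refine ⟨fun e => (w e).re, fun e => (w e).im, ?_, fun e => ?_, fun e => ?_⟩
  · obtain ⟨e, he⟩ := Function.ne_iff.mp hw.2
    refine ⟨e, ?_⟩
    by_contra! h0
    exact he (Complex.ext h0.1 h0.2)
  · have := congrArg Complex.re (congrFun h1 e)
    simpa [Matrix.mulVec, dotProduct] using this
  · have := congrArg Complex.im (congrFun h1 e)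
    simpa [Matrix.mulVec, dotProduct] using this

theorem isEigenvalue_of_mulVec {D : Matrix E E ℝ} {μ : ℝ} {w : E → ℝ} (hw : w ≠ 0)
    (h : ∀ e, D.mulVec w e = μ * w e) : IsEigenvalue D (μ : ℂ) := by
  refine Module.End.hasEigenvalue_of_hasEigenvector (x := fun e => (w e : ℂ))
    ⟨Module.End.mem_eigenspace_iff.mpr ?_, ?_⟩
  · ext e
    have := congrArg (fun x : ℝ => (x : ℂ)) (h e)
    simpa [Matrix.mulVec, dotProduct] using this
  · obtain ⟨e, he⟩ := Function.ne_iff.mp hw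
    exact Function.ne_iff.mpr ⟨e, by simpa using he⟩

variable [Fintype V]

/-- The law of the set `inc x` for a uniformly chosen `x`. -/
def incLaw (inc : V → Finset E) (A : Finset E) : ℝ :=
  ((Finset.univ.filter fun x : V => inc x = A).card : ℝ) / Fintype.card V

/-- The matrix of partial derivatives of the drift. -/
def incJacobian (inc : V → Finset E) (α : ℝ) (v : E → ℝ) : Matrix E E ℝ := fun e f =>
  -(if e = f then 1 else 0) + (∑ x, if e ∈ inc x then
    ((if e = f then α * v f ^ (α - 1) else 0) * weightSum inc α v x -
      v e ^ α * (if f ∈ inc x then α * v f ^ (α - 1) else 0)) / weightSum inc α v x ^ 2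
    else 0) / Fintype.card V

theorem drift_incLaw (e : E) :
    drift (incLaw inc) α v e = -v e + (∑ x, selProb inc α v x e) / Fintype.card V := by
  unfold drift incLaw
  congr 1
  have h : ∀ A : Finset E, ((Finset.univ.filter fun x : V => inc x = A).card : ℝ)
      = ∑ x : V, if inc x = A then 1 else 0 := by
    intro A
    simp
  simp only [h, Finset.sum_div, Finset.sum_mul]
  rw [Finset.sum_comm]
  refine Finset.sum_congr rfl fun x _ => ?_
  rw [Finset.sum_filter, Finset.sum_eq_single (inc x)]
  · unfold selProb weightSum
    by_cases he : e ∈ inc x <;> simp [he, div_eq_inv_mul]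
  · intro A _ hA
    simp [hA.symm]
  · simp

theorem hasJacobian_incJacobian (hα : 1 ≤ α) (hS : ∀ x, weightSum inc α v x ≠ 0) :
    HasJacobian (drift (incLaw inc) α) (incJacobian inc α v) v := by
  intro e k
  simp only [drift_incLaw]
  have hS' : ∀ x, HasDerivAt (fun t : ℝ => weightSum inc α (Function.update v k t) x)
      (if k ∈ inc x then α * v k ^ (α - 1) else 0) (v k) := by
    intro x
    have := HasDerivAt.fun_sum (u := inc x) fun f _ => hasDerivAt_update_rpow (v := v) hα f k
    simpa [weightSum] using this
  have hid : HasDerivAt (fun t : ℝ => Function.update v k t e) (if e = k then 1 else 0)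
      (v k) := by
    by_cases h : e = k
    · subst h
      simpa using hasDerivAt_id' (v e)
    · simpa [h] using hasDerivAt_const (v k) (v e)
  have hp : ∀ x, HasDerivAt (fun t : ℝ => selProb inc α (Function.update v k t) x e)
      (if e ∈ inc x then
        ((if e = k then α * v k ^ (α - 1) else 0) * weightSum inc α v x -
          v e ^ α * (if k ∈ inc x then α * v k ^ (α - 1) else 0)) / weightSum inc α v x ^ 2
        else 0) (v k) := by
    intro x
    by_cases h : e ∈ inc x
    · simp only [selProb, h, if_true]
      have := (hasDerivAt_update_rpow (v := v) hα e k).fun_div (hS' x) (by simpa using hS x)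
      simpa only [Function.update_eq_self] using this
    · simpa [selProb, h] using hasDerivAt_const (v k) (0 : ℝ)
  exact hid.fun_neg.fun_add ((HasDerivAt.fun_sum fun x _ => hp x).div_const _)

/-- Total mass one is automatic: each vertex distributes probability one among its edges, and the
vertices are averaged. -/
theorem isEquilibrium_incLaw [Nonempty V] (hv : ∀ e, 0 ≤ v e)
    (hS : ∀ x, weightSum inc α v x ≠ 0)
    (h : ∀ e, v e = (∑ x, selProb inc α v x e) / Fintype.card V) :
    IsEquilibrium (incLaw inc) α v := by
  refine ⟨⟨hv, ?_⟩, fun e => by rw [drift_incLaw, ← h e]; ring⟩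
  rw [Finset.sum_congr rfl fun e _ => h e, ← Finset.sum_div, Finset.sum_comm]
  simp only [sum_selProb (hS _)]
  simp

theorem IsEquilibrium.eq_sum_selProb (h : IsEquilibrium (incLaw inc) α v) (e : E) :
    v e = (∑ x, selProb inc α v x e) / Fintype.card V := by
  have := h.2 e
  rw [drift_incLaw] at this
  linarith

/-! ### The spectrum of the matrix of partial derivatives -/

/-- The factor v_f in the perturbation turns v_f^(α-1) into v_f^α, so every derivative becomes α
times a selection probability. The diagonal term produces y_e and the derivative of the denominator
produces the mean. -/
theorem incJacobian_mulVec (hα : 1 < α) (hv : ∀ e, 0 ≤ v e) (hS : ∀ x, weightSum inc α v x ≠ 0)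
    (y : E → ℝ) (e : E) :
    (incJacobian inc α v).mulVec (fun f => v f * y f) e =
      -(v e * y e) + α / Fintype.card V *
        ∑ x, selProb inc α v x e * (y e - selMean inc α v x y) := by
  have key : ∀ x, ∑ f, (if e ∈ inc x then
    ((if e = f then α * v f ^ (α - 1) else 0) * weightSum inc α v x -
      v e ^ α * (if f ∈ inc x then α * v f ^ (α - 1) else 0)) / weightSum inc α v x ^ 2
    else 0) * (v f * y f) = α * (selProb inc α v x e * (y e - selMean inc α v x y)) := by
    intro x
    by_cases he : e ∈ inc x
    · have h1 : ∀ f, (if e ∈ inc x then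
          ((if e = f then α * v f ^ (α - 1) else 0) * weightSum inc α v x -
            v e ^ α * (if f ∈ inc x then α * v f ^ (α - 1) else 0)) / weightSum inc α v x ^ 2
          else 0) * (v f * y f) =
          (if e = f then α * (v f ^ α / weightSum inc α v x) * y f else 0) -
            α * (v e ^ α / weightSum inc α v x) * (selProb inc α v x f * y f) := by
        intro f
        have h2 := rpow_sub_one_mul_self hα (hv f)
        have h3 := hS x
        simp only [he, if_true, selProb, ← h2]
        split_ifs <;> field_simp <;> ring
      simp only [h1, Finset.sum_sub_distrib, Finset.sum_ite_eq, Finset.mem_univ, if_true,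
        ← Finset.mul_sum]
      rw [selMean, selProb, if_pos he]
      ring
    · simp [he, selProb]
  unfold Matrix.mulVec dotProduct incJacobian
  simp only [add_mul, Finset.sum_add_distrib]
  congr 1
  · simp
  · simp only [Finset.sum_div, Finset.sum_mul, Finset.mul_sum]
    rw [Finset.sum_comm]
    refine Finset.sum_congr rfl fun x _ => ?_
    have := key x
    calc _ = (∑ f, (if e ∈ inc x then
        ((if e = f then α * v f ^ (α - 1) else 0) * weightSum inc α v x -
          v e ^ α * (if f ∈ inc x then α * v f ^ (α - 1) else 0)) / weightSum inc α v x ^ 2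
        else 0) * (v f * y f)) / Fintype.card V := by
          rw [Finset.sum_div]
          exact Finset.sum_congr rfl fun f _ => by ring
      _ = _ := by rw [this]; ring

/-- For α > 1 both v_e^α and v_e^(α-1) vanish at v_e = 0, so reinforcement has no first-order effect
on an empty edge. -/
theorem incJacobian_mulVec_of_eq_zero (hα : 1 < α) {e : E} (he : v e = 0) (w : E → ℝ) :
    (incJacobian inc α v).mulVec w e = -w e := by
  have h : ∀ f, incJacobian inc α v e f = -(if e = f then 1 else 0) := by
    intro f
    unfold incJacobian
    have h1 : ∀ x, (if e ∈ inc x then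
      ((if e = f then α * v f ^ (α - 1) else 0) * weightSum inc α v x -
        v e ^ α * (if f ∈ inc x then α * v f ^ (α - 1) else 0)) / weightSum inc α v x ^ 2
      else 0) = 0 := by
      intro x
      have h2 : (0 : ℝ) ^ α = 0 := Real.zero_rpow (by linarith)
      have h3 : (0 : ℝ) ^ (α - 1) = 0 := Real.zero_rpow (by linarith)
      by_cases hef : e = f
      · subst hef
        simp [he, h2, h3]
      · simp [hef, he, h2]
    rw [Finset.sum_eq_zero fun x _ => h1 x, zero_div, add_zero]
  simp [Matrix.mulVec, dotProduct, h]

/-- If the total variance of every `y` is at most `θ / α` times its total second moment, then the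
spectrum lies to the left of `θ - 1`. -/
theorem re_le_of_variance_le [Nonempty V] {θ : ℝ} (hα : 1 < α) (hθ : 0 ≤ θ)
    (heq : IsEquilibrium (incLaw inc) α v) (hS : ∀ x, weightSum inc α v x ≠ 0)
    (hvar : ∀ y : E → ℝ,
      α * ∑ x, (selMean inc α v x (fun f => y f ^ 2) - selMean inc α v x y ^ 2) ≤
        θ * ∑ x, selMean inc α v x (fun f => y f ^ 2))
    {μ : ℂ} (hμ : IsEigenvalue (incJacobian inc α v) μ) : μ.re ≤ θ - 1 := by
  have hv : ∀ e, 0 ≤ v e := heq.1.1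
  have hn : (0 : ℝ) < Fintype.card V := by exact_mod_cast Fintype.card_pos
  obtain ⟨a, b, ⟨e₀, h0⟩, ha, hb⟩ := hμ.exists_real
  by_cases hμ1 : μ = -1
  · rw [hμ1]; simpa using hθ
  -- On an empty edge the eigenvector equation reads (μ + 1) w_e = 0; its real and imaginary parts
  -- are solved with determinant |μ + 1|². The vanishing of w there permits the substitution w =
  -- v·(w/v).
  have hzero : ∀ e, v e = 0 → a e = 0 ∧ b e = 0 := by
    intro e he
    have h1 := ha e
    have h2 := hb e
    rw [incJacobian_mulVec_of_eq_zero hα he] at h1 h2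
    have h3 : (μ.re + 1) ^ 2 + μ.im ^ 2 ≠ 0 := by
      intro h
      apply hμ1
      have h4 : μ.re + 1 = 0 := by nlinarith [sq_nonneg (μ.re + 1), sq_nonneg μ.im]
      have h5 : μ.im = 0 := by nlinarith [sq_nonneg (μ.re + 1), sq_nonneg μ.im]
      exact Complex.ext (by simp; linarith) (by simp [h5])
    constructor
    · refine (mul_eq_zero.mp (?_ : ((μ.re + 1) ^ 2 + μ.im ^ 2) * a e = 0)).resolve_left h3
      linear_combination -(μ.re + 1) * h1 - μ.im * h2
    · refine (mul_eq_zero.mp (?_ : ((μ.re + 1) ^ 2 + μ.im ^ 2) * b e = 0)).resolve_left h3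
      linear_combination -(μ.re + 1) * h2 + μ.im * h1
  have hdiv : ∀ c : E → ℝ, (∀ e, v e = 0 → c e = 0) → c = fun e => v e * (c e / v e) := by
    intro c hc
    ext e
    by_cases he : v e = 0
    · simp [he, hc e he]
    · field_simp
  set y : E → ℝ := fun e => a e / v e with hy
  set z : E → ℝ := fun e => b e / v e with hz
  have hay : a = fun e => v e * y e := hdiv a fun e he => (hzero e he).1
  have hbz : b = fun e => v e * z e := hdiv b fun e he => (hzero e he).2
  rw [hay, hbz] at ha hb h0
  have hform : ∀ y : E → ℝ,
      ∑ e, y e * ∑ x, selProb inc α v x e * (y e - selMean inc α v x y) =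
        ∑ x, (selMean inc α v x (fun f => y f ^ 2) - selMean inc α v x y ^ 2) := by
    intro y
    simp only [Finset.mul_sum]
    rw [Finset.sum_comm]
    refine Finset.sum_congr rfl fun x _ => ?_
    have : ∀ e, y e * (selProb inc α v x e * (y e - selMean inc α v x y)) =
        selProb inc α v x e * y e ^ 2 - selProb inc α v x e * y e * selMean inc α v x y := by
      intro e; ring
    simp only [this, Finset.sum_sub_distrib, ← Finset.sum_mul]
    simp only [selMean]
    ring
  have hmass : ∀ y : E → ℝ, ∑ x, selMean inc α v x (fun f => y f ^ 2) =
      Fintype.card V * ∑ e, v e * y e ^ 2 := by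
    intro y
    simp only [selMean]
    rw [Finset.sum_comm, Finset.mul_sum]
    refine Finset.sum_congr rfl fun e _ => ?_
    rw [← Finset.sum_mul, heq.eq_sum_selProb e]
    field_simp
  -- The real row is paired with y and the imaginary row with z; the terms with μ.im cancel.
  have hsum : (μ.re + 1) * (∑ e, v e * y e ^ 2 + ∑ e, v e * z e ^ 2) =
      α / Fintype.card V * (∑ x, (selMean inc α v x (fun f => y f ^ 2) - selMean inc α v x y ^ 2)
        + ∑ x, (selMean inc α v x (fun f => z f ^ 2) - selMean inc α v x z ^ 2)) := by
    rw [← hform y, ← hform z, ← Finset.sum_add_distrib, ← Finset.sum_add_distrib,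
      Finset.mul_sum, Finset.mul_sum]
    refine Finset.sum_congr rfl fun e _ => ?_
    have h1 := ha e
    have h2 := hb e
    rw [incJacobian_mulVec hα hv hS] at h1 h2
    linear_combination -(y e) * h1 - (z e) * h2
  have hpos : 0 < ∑ e, v e * y e ^ 2 + ∑ e, v e * z e ^ 2 := by
    rw [← Finset.sum_add_distrib]
    refine Finset.sum_pos' (fun e _ => ?_) ⟨e₀, Finset.mem_univ _, ?_⟩
    · have := hv e
      positivity
    · have hve : 0 < v e₀ := by
        refine (hv e₀).lt_of_ne' fun h => ?_
        simp [h] at h0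
      rcases h0 with h0 | h0
      · have : y e₀ ≠ 0 := right_ne_zero_of_mul h0
        positivity
      · have : z e₀ ≠ 0 := right_ne_zero_of_mul h0
        positivity
  have h1 := hvar y
  have h2 := hvar z
  rw [hmass] at h1 h2
  set A := ∑ e, v e * y e ^ 2
  set B := ∑ e, v e * z e ^ 2
  have h3 : (μ.re + 1) * (A + B) ≤ θ * (A + B) := by
    rw [hsum, div_mul_eq_mul_div, div_le_iff₀ hn]
    linarith
  have := le_of_mul_le_mul_right h3 hpos
  linarith

theorem isLinearlyStable_of_variance_le [Nonempty V] {θ : ℝ} (hα : 1 < α) (hθ : 0 ≤ θ)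
    (hθ1 : θ < 1) (heq : IsEquilibrium (incLaw inc) α v) (hS : ∀ x, weightSum inc α v x ≠ 0)
    (hvar : ∀ y : E → ℝ,
      α * ∑ x, (selMean inc α v x (fun f => y f ^ 2) - selMean inc α v x y ^ 2) ≤
        θ * ∑ x, selMean inc α v x (fun f => y f ^ 2)) :
    IsLinearlyStable (incLaw inc) α v :=
  ⟨heq, _, hasJacobian_incJacobian hα.le hS, fun μ hμ => by
    have := re_le_of_variance_le hα hθ heq hS hvar hμ
    linarith⟩

/-- Linear stability when, at every `x`, all colours but one have small probability. -/
theorem isLinearlyStable_of_selProb_le [Nonempty V] {ε : ℝ} (hα : 1 < α) (hε : 0 ≤ ε)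
    (hε1 : 4 * α * ε * (Fintype.card V * Fintype.card E) < 1)
    (heq : IsEquilibrium (incLaw inc) α v)
    (hlow : ∀ e, v e ≠ 0 → 1 ≤ Fintype.card V * v e)
    (hdom : ∀ x, ∃ h ∈ inc x, v h ≠ 0 ∧ ∀ f, f ≠ h → selProb inc α v x f ≤ ε) :
    IsLinearlyStable (incLaw inc) α v := by
  have hv : ∀ e, 0 ≤ v e := heq.1.1
  have hn : (0 : ℝ) < Fintype.card V := by exact_mod_cast Fintype.card_pos
  have hS : ∀ x, weightSum inc α v x ≠ 0 := fun x => by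
    obtain ⟨h, hx, h0, -⟩ := hdom x
    exact (weightSum_pos hv hx ((hv h).lt_of_ne' h0)).ne'
  refine isLinearlyStable_of_variance_le hα (by positivity) hε1 heq hS fun y => ?_
  have hmass : ∑ x, selMean inc α v x (fun f => y f ^ 2) =
      ∑ e, Fintype.card V * v e * y e ^ 2 := by
    simp only [selMean]
    rw [Finset.sum_comm]
    refine Finset.sum_congr rfl fun e _ => ?_
    rw [← Finset.sum_mul, heq.eq_sum_selProb e]
    field_simp
  rw [hmass]
  set A := ∑ e, Fintype.card V * v e * y e ^ 2 with hA
  -- The lower bound on nonzero weights lets the total second moment control each single y_e².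
  have hyA : ∀ e, v e ≠ 0 → y e ^ 2 ≤ A := by
    intro e he
    calc y e ^ 2 ≤ Fintype.card V * v e * y e ^ 2 :=
          le_mul_of_one_le_left (sq_nonneg _) (hlow e he)
      _ ≤ A := Finset.single_le_sum (f := fun e => (Fintype.card V : ℝ) * v e * y e ^ 2)
          (fun f _ => by have := hv f; positivity) (Finset.mem_univ e)
  have hA0 : 0 ≤ A := Finset.sum_nonneg fun f _ => by have := hv f; positivity
  have hx : ∀ x, selMean inc α v x (fun f => y f ^ 2) - selMean inc α v x y ^ 2 ≤
      Fintype.card E * (4 * ε * A) := by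
    intro x
    obtain ⟨h, -, h0, hf⟩ := hdom x
    -- The variance is at most the second moment about any point; the value at the dominant edge is
    -- chosen, so that this edge contributes nothing.
    have h1 : selMean inc α v x (fun f => y f ^ 2) - selMean inc α v x y ^ 2 ≤
        ∑ f, selProb inc α v x f * (y f - y h) ^ 2 := by
      have h2 : ∑ f, selProb inc α v x f * (y f - y h) ^ 2 =
          selMean inc α v x (fun f => y f ^ 2) - 2 * y h * selMean inc α v x y + y h ^ 2 := by
        have h3 : ∀ f, selProb inc α v x f * (y f - y h) ^ 2 = selProb inc α v x f * y f ^ 2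
            - 2 * y h * (selProb inc α v x f * y f) + selProb inc α v x f * y h ^ 2 := by
          intro f; ring
        simp only [h3, Finset.sum_add_distrib, Finset.sum_sub_distrib, ← Finset.mul_sum,
          ← Finset.sum_mul, sum_selProb (hS x), selMean, one_mul]
      rw [h2]
      nlinarith [sq_nonneg (selMean inc α v x y - y h)]
    refine h1.trans ?_
    have h4 : ∀ f ∈ Finset.univ, selProb inc α v x f * (y f - y h) ^ 2 ≤ 4 * ε * A := by
      intro f _
      by_cases hfh : f = h
      · subst hfh
        simp only [sub_self, ne_eq, OfNat.ofNat_ne_zero, not_false_eq_true, zero_pow, mul_zero]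
        positivity
      by_cases hvf : v f = 0
      · rw [selProb_eq_zero (by linarith) hvf, zero_mul]
        positivity
      · have h5 : (y f - y h) ^ 2 ≤ 4 * A := by
          nlinarith [hyA f hvf, hyA h h0, sq_nonneg (y f + y h)]
        calc _ ≤ ε * (4 * A) := mul_le_mul (hf f hfh) h5 (sq_nonneg _) hε
          _ = _ := by ring
    calc _ ≤ ∑ _f : E, 4 * ε * A := Finset.sum_le_sum h4
      _ = _ := by simp
  calc α * ∑ x, (selMean inc α v x (fun f => y f ^ 2) - selMean inc α v x y ^ 2)
      ≤ α * ∑ _x : V, Fintype.card E * (4 * ε * A) :=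
        mul_le_mul_of_nonneg_left (Finset.sum_le_sum fun x _ => hx x) (by linarith)
    _ = _ := by simp; ring

end Incidence

/-! ### The threshold function -/

section Threshold

/-- For α ≤ 2 one has 2(α - 1) ≤ α, so the value is at most (α - 1) log α - α log α = -log α. -/
theorem thresholdFun_neg {α : ℝ} (h1 : 1 < α) (h2 : α ≤ 2) : thresholdFun α < 0 := by
  unfold thresholdFun
  have h3 : Real.log (2 * (α - 1)) ≤ Real.log α :=
    Real.log_le_log (by linarith) (by linarith)
  have h4 : 0 < Real.log α := Real.log_pos h1
  nlinarith

theorem hasDerivAt_thresholdFun {α : ℝ} (h1 : 1 < α) :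
    HasDerivAt thresholdFun (Real.log (2 * (α - 1)) - Real.log α) α := by
  have hα : α ≠ 0 := by linarith
  have hα1 : α - 1 ≠ 0 := by linarith
  have ha : HasDerivAt (fun x : ℝ => x - 1) 1 α := (hasDerivAt_id α).sub_const 1
  have hb : HasDerivAt (fun x : ℝ => Real.log (2 * (x - 1))) (2 * 1 / (2 * (α - 1))) α :=
    (ha.const_mul 2).log (by simpa using hα1)
  have hc : HasDerivAt (fun x : ℝ => x * Real.log x) (1 * Real.log α + α * α⁻¹) α :=
    (hasDerivAt_id α).mul (Real.hasDerivAt_log hα)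
  have := (ha.mul hb).sub hc
  refine this.congr_deriv ?_
  field_simp
  ring

theorem strictMonoOn_thresholdFun : StrictMonoOn thresholdFun (Set.Ici 2) := by
  refine strictMonoOn_of_deriv_pos (convex_Ici 2) (fun x hx => ?_) fun x hx => ?_
  · exact (hasDerivAt_thresholdFun (by linarith [Set.mem_Ici.mp hx])).continuousAt.continuousWithinAt
  · rw [interior_Ici, Set.mem_Ioi] at hx
    rw [(hasDerivAt_thresholdFun (by linarith)).deriv, sub_pos]
    exact Real.log_lt_log (by linarith) (by linarith)

theorem tendsto_thresholdFun : Tendsto thresholdFun atTop atTop := by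
  -- Linear minorant: the derivative log(2(α - 1)/α) is at least log(3/2) from α = 4 on.
  have h1 : Tendsto (fun α : ℝ => thresholdFun 4 + Real.log (3 / 2) * (α - 4)) atTop atTop := by
    refine tendsto_atTop_add_const_left _ _ (Tendsto.const_mul_atTop (Real.log_pos (by norm_num)) ?_)
    exact tendsto_atTop_add_const_right _ _ tendsto_id
  refine tendsto_atTop_mono' _ ?_ h1
  filter_upwards [eventually_ge_atTop 4] with α hα
  have h2 : Real.log (3 / 2) * (α - 4) ≤ thresholdFun α - thresholdFun 4 := by
    refine (convex_Ici (4 : ℝ)).mul_sub_le_image_sub_of_le_deriv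
      (fun x hx => ?_) (fun x hx => ?_) (fun x hx => ?_) 4 (by simp) α hα hα
    · exact (hasDerivAt_thresholdFun
        (by linarith [Set.mem_Ici.mp hx])).continuousAt.continuousWithinAt
    · rw [interior_Ici, Set.mem_Ioi] at hx
      exact (hasDerivAt_thresholdFun (by linarith)).differentiableAt.differentiableWithinAt
    · rw [interior_Ici, Set.mem_Ioi] at hx
      rw [(hasDerivAt_thresholdFun (by linarith)).deriv,
        ← Real.log_div (by linarith) (by linarith)]
      refine Real.log_le_log (by norm_num) ?_
      rw [le_div_iff₀ (by linarith)]
      linarith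
  linarith

/-- For `c ≥ 2` the threshold function crosses the level `log (c / 2)` exactly once. -/
theorem exists_threshold {c : ℝ} (hc : 2 ≤ c) :
    ∃ a : ℝ, 2 < a ∧ thresholdFun a = Real.log (c / 2) ∧
      (∀ α, a < α → Real.log (c / 2) < thresholdFun α) ∧
      ∀ α, 1 < α → α < a → thresholdFun α < Real.log (c / 2) := by
  have h0 : 0 ≤ Real.log (c / 2) := Real.log_nonneg (by linarith)
  have h2 : thresholdFun 2 < 0 := thresholdFun_neg (by norm_num) le_rfl
  obtain ⟨b, hb, hb2⟩ := ((tendsto_thresholdFun.eventually_ge_atTop (Real.log (c / 2))).and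
    (eventually_ge_atTop 2)).exists
  have hcont : ContinuousOn thresholdFun (Set.Icc 2 b) := fun x hx =>
    (hasDerivAt_thresholdFun (by linarith [hx.1])).continuousAt.continuousWithinAt
  obtain ⟨a, ha, hac⟩ := intermediate_value_Icc hb2 hcont ⟨h2.le.trans h0, hb⟩
  have ha2 : 2 < a := by
    refine ha.1.lt_of_ne fun h => ?_
    rw [← h] at hac
    linarith
  refine ⟨a, ha2, hac, fun α hα => ?_, fun α h1 hα => ?_⟩
  · rw [← hac]
    exact strictMonoOn_thresholdFun (Set.mem_Ici.mpr ha2.le)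
      (Set.mem_Ici.mpr (ha2.trans hα).le) hα
  · rcases le_total α 2 with h | h
    · exact (thresholdFun_neg h1 h).trans_le h0
    · rw [← hac]
      exact strictMonoOn_thresholdFun (Set.mem_Ici.mpr h) (Set.mem_Ici.mpr ha2.le) hα

theorem rpow_eq_of_thresholdFun_eq {a c : ℝ} (ha : 1 < a) (hc : 0 < c)
    (h : thresholdFun a = Real.log (c / 2)) :
    (2 * (1 - 1 / a)) ^ (a - 1) = a / 2 * c := by
  have ha0 : 0 < a := by linarith
  have h1 : 2 * (1 - 1 / a) = 2 * (a - 1) / a := by field_simp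
  have h2 : 0 < 2 * (a - 1) / a := div_pos (by linarith) ha0
  rw [h1, Real.rpow_def_of_pos h2, Real.log_div (by linarith) ha0.ne']
  have h3 : (Real.log (2 * (a - 1)) - Real.log a) * (a - 1) =
      Real.log a + Real.log (c / 2) := by
    rw [← h, thresholdFun]
    ring
  rw [h3, Real.exp_add, Real.exp_log ha0, Real.exp_log (by linarith)]
  ring

end Threshold

/-! ### The equation `2 t = 1 + c t ^ α` -/

section RatioEquation

/-- Its positive zeros are the quotients `v / u` of the symmetric equilibria
`((v)_r, u, (v)_r)`, where `c = r + 1`. -/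
def ratioFun (c α t : ℝ) : ℝ := c * t ^ α - 2 * t + 1

/-- The minimiser of `ratioFun c α`. -/
def ratioMin (c α : ℝ) : ℝ := (2 / (α * c)) ^ (1 / (α - 1))

variable {c α t : ℝ}

theorem ratioMin_pos (hc : 0 < c) (hα : 1 < α) : 0 < ratioMin c α := by
  have : 0 < α := by linarith
  unfold ratioMin
  positivity

theorem ratioMin_rpow (hc : 0 < c) (hα : 1 < α) : α * c * ratioMin c α ^ (α - 1) = 2 := by
  have h0 : 0 < α := by linarith
  have h1 : α - 1 ≠ 0 := by linarith
  rw [ratioMin, ← Real.rpow_mul (by positivity), one_div_mul_cancel h1, Real.rpow_one]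
  field_simp

theorem continuous_ratioFun (hα : 1 < α) : Continuous (ratioFun c α) := by
  have : Continuous fun t : ℝ => t ^ α := Real.continuous_rpow_const (by linarith)
  unfold ratioFun
  fun_prop

theorem hasDerivAt_ratioFun (hα : 1 < α) (t : ℝ) :
    HasDerivAt (ratioFun c α) (α * c * t ^ (α - 1) - 2) t := by
  have h1 := (Real.hasDerivAt_rpow_const (x := t) (Or.inr hα.le)).const_mul c
  have h2 : HasDerivAt (fun t : ℝ => 2 * t) 2 t := by
    simpa using (hasDerivAt_id t).const_mul (2 : ℝ)
  refine ((h1.sub h2).add_const 1).congr_deriv ?_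
  ring

/-- The right side says that the derivative of `ratioFun` at t is negative. The same inequality will
say that the leading eigenvalue is negative. -/
theorem lt_ratioMin_iff (hc : 0 < c) (hα : 1 < α) (ht : 0 ≤ t) :
    t < ratioMin c α ↔ α * c * t ^ (α - 1) < 2 := by
  have h0 : 0 < α * c := by nlinarith
  conv_rhs => rw [← ratioMin_rpow hc hα]
  rw [mul_lt_mul_iff_right₀ h0,
    Real.rpow_lt_rpow_iff ht (ratioMin_pos hc hα).le (by linarith)]

theorem ratioMin_lt_iff (hc : 0 < c) (hα : 1 < α) (ht : 0 ≤ t) :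
    ratioMin c α < t ↔ 2 < α * c * t ^ (α - 1) := by
  have h0 : 0 < α * c := by nlinarith
  conv_rhs => lhs; rw [← ratioMin_rpow hc hα]
  rw [mul_lt_mul_iff_right₀ h0,
    Real.rpow_lt_rpow_iff (ratioMin_pos hc hα).le ht (by linarith)]

theorem strictAntiOn_ratioFun (hc : 0 < c) (hα : 1 < α) :
    StrictAntiOn (ratioFun c α) (Set.Icc 0 (ratioMin c α)) := by
  refine strictAntiOn_of_deriv_neg (convex_Icc _ _) (continuous_ratioFun hα).continuousOn
    fun x hx => ?_
  rw [interior_Icc] at hx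
  rw [(hasDerivAt_ratioFun hα x).deriv, sub_neg]
  exact (lt_ratioMin_iff hc hα hx.1.le).mp hx.2

theorem strictMonoOn_ratioFun (hc : 0 < c) (hα : 1 < α) :
    StrictMonoOn (ratioFun c α) (Set.Ici (ratioMin c α)) := by
  refine strictMonoOn_of_deriv_pos (convex_Ici _) (continuous_ratioFun hα).continuousOn
    fun x hx => ?_
  rw [interior_Ici] at hx
  rw [(hasDerivAt_ratioFun hα x).deriv, sub_pos]
  exact (ratioMin_lt_iff hc hα ((ratioMin_pos hc hα).trans hx).le).mp hx

/-- The critical-point equation replaces c t^α by 2t/α. -/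
theorem ratioFun_ratioMin (hc : 0 < c) (hα : 1 < α) :
    ratioFun c α (ratioMin c α) = 1 - 2 * (1 - 1 / α) * ratioMin c α := by
  have h0 : 0 < α := by linarith
  have h1 := ratioMin_rpow hc hα
  have hp := ratioMin_pos hc hα
  rw [Real.rpow_sub_one hp.ne'] at h1
  unfold ratioFun
  have h2 : c * ratioMin c α ^ α = 2 * ratioMin c α / α := by
    field_simp at h1 ⊢
    linarith
  rw [h2]
  ring

/-- This is where the threshold function originates: the minimum of `ratioFun` is one minus the
argument of this logarithm, so its sign is decided by comparing `thresholdFun α` with log(c/2). -/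
theorem log_ratioFun_ratioMin (hc : 0 < c) (hα : 1 < α) :
    (α - 1) * Real.log (2 * (1 - 1 / α) * ratioMin c α) =
      thresholdFun α - Real.log (c / 2) := by
  have h0 : 0 < α := by linarith
  have h1 : α - 1 ≠ 0 := by linarith
  have h2 : 2 * (1 - 1 / α) = 2 * (α - 1) / α := by field_simp
  have h3 : 0 < 2 * (α - 1) := by linarith
  rw [h2, Real.log_mul (by positivity) (ratioMin_pos hc hα).ne', Real.log_div h3.ne' h0.ne',
    ratioMin, Real.log_rpow (by positivity), Real.log_div two_ne_zero (by positivity),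
    Real.log_mul h0.ne' hc.ne', Real.log_div hc.ne' two_ne_zero, thresholdFun]
  field_simp
  ring

theorem ratioFun_ratioMin_neg (hc : 0 < c) (hα : 1 < α)
    (h : Real.log (c / 2) < thresholdFun α) : ratioFun c α (ratioMin c α) < 0 := by
  have h0 : 0 < α := by linarith
  have h1 := log_ratioFun_ratioMin hc hα
  have h2 : 0 < Real.log (2 * (1 - 1 / α) * ratioMin c α) := by
    by_contra! h3
    nlinarith
  have h3 : 0 < 1 - 1 / α := by
    rw [sub_pos, div_lt_one h0]; exact hα
  have h4 := (Real.log_pos_iff (mul_pos (mul_pos two_pos h3) (ratioMin_pos hc hα)).le).mp h2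
  rw [ratioFun_ratioMin hc hα]
  linarith

theorem ratioFun_pos (hc : 0 < c) (hα : 1 < α) (h : thresholdFun α < Real.log (c / 2))
    (ht : 0 ≤ t) : 0 < ratioFun c α t := by
  have h0 : 0 < α := by linarith
  have h1 := log_ratioFun_ratioMin hc hα
  have h2 : Real.log (2 * (1 - 1 / α) * ratioMin c α) < 0 := by
    by_contra! h3
    nlinarith
  have h3 : 0 < 1 - 1 / α := by
    rw [sub_pos, div_lt_one h0]; exact hα
  have hp := ratioMin_pos hc hα
  have h4 := (Real.log_neg_iff (mul_pos (mul_pos two_pos h3) hp)).mp h2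
  have h5 : 0 < ratioFun c α (ratioMin c α) := by
    rw [ratioFun_ratioMin hc hα]
    linarith
  refine h5.trans_le ?_
  rcases le_total t (ratioMin c α) with h | h
  · exact (strictAntiOn_ratioFun hc hα).antitoneOn ⟨ht, h⟩ ⟨hp.le, le_rfl⟩ h
  · exact (strictMonoOn_ratioFun hc hα).monotoneOn (Set.mem_Ici.mpr le_rfl) h h

theorem half_lt_of_ratioFun_eq_zero (hc : 0 < c) (ht : 0 < t) (h : ratioFun c α t = 0) :
    1 / 2 < t := by
  have : 0 < c * t ^ α := mul_pos hc (Real.rpow_pos_of_pos ht α)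
  unfold ratioFun at h
  linarith

theorem lt_one_of_ratioFun_eq_zero (hc : 2 ≤ c) (hα : 1 < α) (h : ratioFun c α t = 0) :
    t < 1 := by
  by_contra! h1
  have h2 : t ≤ t ^ α := Real.self_le_rpow_of_one_le h1 hα.le
  unfold ratioFun at h
  nlinarith

/-- Above the threshold the equation has exactly two positive solutions, one on either side of
the minimiser. -/
theorem exists_ratio_roots (hc : 2 ≤ c) (hα : 1 < α) (h : Real.log (c / 2) < thresholdFun α) :
    ∃ t₁ t₂, 0 < t₁ ∧ t₁ < ratioMin c α ∧ ratioMin c α < t₂ ∧ ratioFun c α t₁ = 0 ∧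
      ratioFun c α t₂ = 0 ∧ ∀ t, 0 < t → ratioFun c α t = 0 → t = t₁ ∨ t = t₂ := by
  have hc0 : 0 < c := by linarith
  have hp := ratioMin_pos hc0 hα
  have hneg := ratioFun_ratioMin_neg hc0 hα h
  have hcont : Continuous (ratioFun c α) := continuous_ratioFun hα
  have h0 : ratioFun c α 0 = 1 := by
    simp [ratioFun, Real.zero_rpow (by linarith : α ≠ 0)]
  obtain ⟨t₁, ht₁, h₁⟩ := intermediate_value_Icc' hp.le hcont.continuousOn
    (show (0 : ℝ) ∈ Set.Icc _ _ from ⟨hneg.le, by rw [h0]; exact zero_le_one⟩)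
  -- At x = `ratioMin` + 1 ≥ 1 one has x^α ≥ x, hence c x^α - 2x + 1 ≥ 1 because c ≥ 2.
  have hbig : 0 ≤ ratioFun c α (ratioMin c α + 1) := by
    have h1 : ratioMin c α + 1 ≤ (ratioMin c α + 1) ^ α :=
      Real.self_le_rpow_of_one_le (by linarith) hα.le
    unfold ratioFun
    nlinarith
  obtain ⟨t₂, ht₂, h₂⟩ := intermediate_value_Icc (by linarith : ratioMin c α ≤ ratioMin c α + 1)
    hcont.continuousOn (show (0 : ℝ) ∈ Set.Icc _ _ from ⟨hneg.le, hbig⟩)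
  have ht₁0 : 0 < t₁ := ht₁.1.lt_of_ne fun h => by rw [← h, h0] at h₁; norm_num at h₁
  have ht₁m : t₁ < ratioMin c α := ht₁.2.lt_of_ne fun h => by rw [h] at h₁; linarith
  have ht₂m : ratioMin c α < t₂ := ht₂.1.lt_of_ne fun h => by rw [← h] at h₂; linarith
  refine ⟨t₁, t₂, ht₁0, ht₁m, ht₂m, h₁, h₂, fun t ht h0 => ?_⟩
  rcases le_total t (ratioMin c α) with h | h
  · exact Or.inl ((strictAntiOn_ratioFun hc0 hα).injOn ⟨ht.le, h⟩ ⟨ht₁0.le, ht₁m.le⟩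
      (h0.trans h₁.symm))
  · exact Or.inr ((strictMonoOn_ratioFun hc0 hα).injOn h ht₂m.le (h0.trans h₂.symm))

/-- The smaller solution strictly decreases in the exponent. -/
theorem ratio_root_lt {β s : ℝ} (hc : 2 ≤ c) (hα : 1 < α) (hαβ : α < β) (ht : 0 < t)
    (h : ratioFun c α t = 0) (hs : 0 < s) (hsm : s < ratioMin c β) (h' : ratioFun c β s = 0) :
    s < t := by
  by_contra! hle
  have hc0 : 0 < c := by linarith
  have h1 : t ^ β < t ^ α := Real.rpow_lt_rpow_of_exponent_gt ht
    (lt_one_of_ratioFun_eq_zero hc hα h) hαβ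
  -- Since t < 1, raising the exponent makes the function negative at t; to the left of its first
  -- zero s it would be nonnegative.
  have h2 : ratioFun c β t < 0 := by
    rw [← h]
    unfold ratioFun
    nlinarith
  have h3 := (strictAntiOn_ratioFun hc0 (hα.trans hαβ)).antitoneOn
    ⟨ht.le, hle.trans hsm.le⟩ ⟨hs.le, hsm.le⟩ hle
  linarith

/-- The smaller solution tends to `1 / 2`. -/
theorem tendsto_ratio_root {a : ℝ} {τ : ℝ → ℝ} (hc : 2 ≤ c) (ha : 1 < a)
    (hpos : ∀ α, a < α → 0 < τ α) (hroot : ∀ α, a < α → ratioFun c α (τ α) = 0)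
    (hanti : StrictAntiOn τ (Set.Ioi a)) : Tendsto τ atTop (𝓝 (1 / 2)) := by
  have hb : a < a + 1 := by linarith
  have hlt : τ (a + 1) < 1 := lt_one_of_ratioFun_eq_zero hc (by linarith) (hroot _ hb)
  -- The root satisfies τ = 1/2 + (c/2) τ^α, and by monotonicity its base is bounded by the fixed
  -- number τ(a + 1) < 1.
  have h1 : Tendsto (fun α : ℝ => 1 / 2 + c / 2 * τ (a + 1) ^ α) atTop (𝓝 (1 / 2)) := by
    have := (tendsto_rpow_atTop_of_base_lt_one (τ (a + 1)) (by linarith [hpos _ hb]) hlt)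
    simpa only [mul_zero, add_zero] using (this.const_mul (c / 2)).const_add (1 / 2)
  refine tendsto_of_tendsto_of_tendsto_of_le_of_le' tendsto_const_nhds h1 ?_ ?_
  · filter_upwards [eventually_gt_atTop a] with α hα
    exact (half_lt_of_ratioFun_eq_zero (by linarith) (hpos α hα) (hroot α hα)).le
  · filter_upwards [eventually_gt_atTop (a + 1)] with α hα
    have hα' : a < α := hb.trans hα
    have h2 : τ α ≤ τ (a + 1) := (hanti (Set.mem_Ioi.mpr hb) (Set.mem_Ioi.mpr hα') hα).le
    have h3 : τ α ^ α ≤ τ (a + 1) ^ α := Real.rpow_le_rpow (hpos α hα').le h2 (by linarith)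
    have h4 := hroot α hα'
    unfold ratioFun at h4
    nlinarith

end RatioEquation

/-! ### Graphs as incidence systems -/

section Graph

open Classical

variable {V : Type*} [Fintype V] {G : SimpleGraph V}

theorem graphLaw_eq_incLaw (G : SimpleGraph V) : graphLaw G = incLaw (incidentEdges G) := by
  ext A
  unfold graphLaw incLaw
  congr

theorem mem_incidentEdges {x : V} {e : G.edgeSet} :
    e ∈ incidentEdges G x ↔ x ∈ (e : Sym2 V) := by
  simp [incidentEdges]

theorem sum_incidentEdges (φ : Sym2 V → ℝ) (x : V) :
    ∑ f ∈ incidentEdges G x, φ f = ∑ w, if G.Adj x w then φ s(x, w) else 0 := by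
  rw [← Finset.sum_filter]
  symm
  refine Finset.sum_bij (fun w hw => ⟨s(x, w), by simpa using hw⟩) (fun w hw => ?_)
    (fun w hw w' hw' h => ?_) (fun f hf => ?_) fun w hw => rfl
  · simp [mem_incidentEdges]
  · exact Sym2.congr_right.mp (congrArg Subtype.val h)
  · obtain ⟨w, hw⟩ := Sym2.mem_iff_exists.mp (mem_incidentEdges.mp hf)
    have h1 : G.Adj x w := by
      have := f.2
      rwa [hw] at this
    exact ⟨w, by simpa using h1, Subtype.ext hw.symm⟩

theorem weightSum_incidentEdges (α : ℝ) (φ : Sym2 V → ℝ) (x : V) :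
    weightSum (incidentEdges G) α (fun e => φ e) x =
      ∑ w, if G.Adj x w then φ s(x, w) ^ α else 0 :=
  sum_incidentEdges (fun e => φ e ^ α) x

theorem selMean_incidentEdges (α : ℝ) (φ y : Sym2 V → ℝ) (x : V) :
    selMean (incidentEdges G) α (fun e => φ e) x (fun e => y e) =
      ∑ w, if G.Adj x w then φ s(x, w) ^ α /
        weightSum (incidentEdges G) α (fun e => φ e) x * y s(x, w) else 0 := by
  rw [← sum_incidentEdges (fun e => φ e ^ α /
        weightSum (incidentEdges G) α (fun e => φ e) x * y e)]
  simp [selMean, selProb, Finset.sum_ite_mem]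

/-- Only the two endpoints can select an edge. With F = 1 this gives the equilibrium equation, with
F the deviation of y_e from its mean at each vertex a row of the Jacobian. -/
theorem sum_selProb_edge {α : ℝ} {v : G.edgeSet → ℝ} {a b : V} {e : G.edgeSet}
    (h : e.1 = s(a, b)) (F : V → ℝ) :
    ∑ x, selProb (incidentEdges G) α v x e * F x =
      v e ^ α / weightSum (incidentEdges G) α v a * F a +
        v e ^ α / weightSum (incidentEdges G) α v b * F b := by
  have hab : a ≠ b := by
    have := e.2
    rw [h] at this
    exact G.ne_of_adj this
  rw [Finset.sum_eq_add a b hab]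
  · simp [selProb, mem_incidentEdges, h]
  · intro x _ hx
    simp [selProb, mem_incidentEdges, h, hx.1, hx.2]
  · simp
  · simp

end Graph

/-! ### Whisker graphs -/

section Whisker

open Classical

variable {r s : ℕ}

theorem whiskerGraph_adj_centres (r s : ℕ) :
    (whiskerGraph r s).Adj (Sum.inl false) (Sum.inl true) := by
  simp [whiskerGraph]

theorem whiskerGraph_adj_left (i : Fin r) :
    (whiskerGraph r s).Adj (Sum.inl false) (Sum.inr (Sum.inl i)) := by
  simp [whiskerGraph]

theorem whiskerGraph_adj_right (i : Fin s) :
    (whiskerGraph r s).Adj (Sum.inl true) (Sum.inr (Sum.inr i)) := by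
  simp [whiskerGraph]

theorem whiskerGraph_adj_cases {P : Bool ⊕ (Fin r ⊕ Fin s) → Bool ⊕ (Fin r ⊕ Fin s) → Prop}
    (symm : ∀ a b, P a b → P b a) (h0 : P (Sum.inl false) (Sum.inl true))
    (hl : ∀ i, P (Sum.inl false) (Sum.inr (Sum.inl i)))
    (hr : ∀ i, P (Sum.inl true) (Sum.inr (Sum.inr i)))
    {a b : Bool ⊕ (Fin r ⊕ Fin s)} (h : (whiskerGraph r s).Adj a b) : P a b := by
  rcases a with (_ | _) | i | i <;> rcases b with (_ | _) | j | j <;>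
    first
    | exact h0
    | exact hl _
    | exact hr _
    | exact symm _ _ h0
    | exact symm _ _ (hl _)
    | exact symm _ _ (hr _)
    | (simp [whiskerGraph] at h)

/-- The edge joining the two centres. -/
def centreEdge (r s : ℕ) : (whiskerGraph r s).edgeSet :=
  ⟨s(_, _), whiskerGraph_adj_centres r s⟩

/-- The edge of the `i`-th leaf at the first centre. -/
def leftEdge (i : Fin r) : (whiskerGraph r s).edgeSet :=
  ⟨s(_, _), whiskerGraph_adj_left i⟩

/-- The edge of the `i`-th leaf at the second centre. -/
def rightEdge (i : Fin s) : (whiskerGraph r s).edgeSet :=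
  ⟨s(_, _), whiskerGraph_adj_right i⟩

theorem whiskerGraph_edge_cases {P : (whiskerGraph r s).edgeSet → Prop}
    (h0 : P (centreEdge r s)) (hl : ∀ i, P (leftEdge i)) (hr : ∀ i, P (rightEdge i))
    (e : (whiskerGraph r s).edgeSet) : P e := by
  obtain ⟨e, he⟩ := e
  induction e using Sym2.ind with
  | _ a b =>
    have := whiskerGraph_adj_cases (P := fun a b => ∀ h : s(a, b) ∈ (whiskerGraph r s).edgeSet,
      P ⟨s(a, b), h⟩) (fun a b h => by simpa only [Sym2.eq_swap] using h) (fun _ => h0)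
      (fun i _ => hl i) (fun i _ => hr i) he
    exact this he

theorem sum_whiskerGraph_false (φ : Sym2 (Bool ⊕ (Fin r ⊕ Fin s)) → ℝ) :
    (∑ b, if (whiskerGraph r s).Adj (Sum.inl false) b then φ s(Sum.inl false, b) else 0) =
      φ s(Sum.inl false, Sum.inl true) + ∑ i, φ s(Sum.inl false, Sum.inr (Sum.inl i)) := by
  simp [Fintype.sum_sum_type, whiskerGraph]

theorem sum_whiskerGraph_true (φ : Sym2 (Bool ⊕ (Fin r ⊕ Fin s)) → ℝ) :
    (∑ b, if (whiskerGraph r s).Adj (Sum.inl true) b then φ s(Sum.inl true, b) else 0) =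
      φ s(Sum.inl false, Sum.inl true) + ∑ i, φ s(Sum.inl true, Sum.inr (Sum.inr i)) := by
  simp [Fintype.sum_sum_type, whiskerGraph, Sym2.eq_swap]

theorem sum_whiskerGraph_left (φ : Sym2 (Bool ⊕ (Fin r ⊕ Fin s)) → ℝ) (i : Fin r) :
    (∑ b, if (whiskerGraph r s).Adj (Sum.inr (Sum.inl i)) b then
      φ s(Sum.inr (Sum.inl i), b) else 0) = φ s(Sum.inl false, Sum.inr (Sum.inl i)) := by
  simp [Fintype.sum_sum_type, whiskerGraph, Sym2.eq_swap]

theorem sum_whiskerGraph_right (φ : Sym2 (Bool ⊕ (Fin r ⊕ Fin s)) → ℝ) (i : Fin s) :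
    (∑ b, if (whiskerGraph r s).Adj (Sum.inr (Sum.inr i)) b then
      φ s(Sum.inr (Sum.inr i), b) else 0) = φ s(Sum.inl true, Sum.inr (Sum.inr i)) := by
  simp [Fintype.sum_sum_type, whiskerGraph, Sym2.eq_swap]

/-- The value `u` on the edge joining the centres and `v` elsewhere. -/
def whiskerWeight (r s : ℕ) (v u : ℝ) (e : Sym2 (Bool ⊕ (Fin r ⊕ Fin s))) : ℝ :=
  if e = s(Sum.inl false, Sum.inl true) then u else v

variable (v u : ℝ)

theorem whiskerVector_eq (r : ℕ) (v u : ℝ) :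
    whiskerVector r v u =
      fun e : (whiskerGraph r r).edgeSet => whiskerWeight r r v u e.1 := by
  ext e
  unfold whiskerVector whiskerWeight
  congr

@[simp]
theorem whiskerWeight_centre :
    whiskerWeight r s v u s(Sum.inl false, Sum.inl true) = u := by
  simp [whiskerWeight]

@[simp]
theorem whiskerWeight_left (i : Fin r) :
    whiskerWeight r s v u s(Sum.inl false, Sum.inr (Sum.inl i)) = v := by
  simp [whiskerWeight]

@[simp]
theorem whiskerWeight_right (i : Fin s) :
    whiskerWeight r s v u s(Sum.inl true, Sum.inr (Sum.inr i)) = v := by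
  simp [whiskerWeight]

/-- The sum of the `α`-th powers of the weights at the vertex `a`. -/
def whiskerSum (r s : ℕ) (α v u : ℝ) (a : Bool ⊕ (Fin r ⊕ Fin s)) : ℝ :=
  ∑ b, if (whiskerGraph r s).Adj a b then whiskerWeight r s v u s(a, b) ^ α else 0

variable (α : ℝ)

@[simp]
theorem whiskerSum_false : whiskerSum r s α v u (Sum.inl false) = u ^ α + r * v ^ α := by
  rw [whiskerSum, sum_whiskerGraph_false fun e => whiskerWeight r s v u e ^ α]
  simp

@[simp]
theorem whiskerSum_true : whiskerSum r s α v u (Sum.inl true) = u ^ α + s * v ^ α := by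
  rw [whiskerSum, sum_whiskerGraph_true fun e => whiskerWeight r s v u e ^ α]
  simp

@[simp]
theorem whiskerSum_left (i : Fin r) :
    whiskerSum r s α v u (Sum.inr (Sum.inl i)) = v ^ α := by
  rw [whiskerSum, sum_whiskerGraph_left fun e => whiskerWeight r s v u e ^ α]
  simp

@[simp]
theorem whiskerSum_right (i : Fin s) :
    whiskerSum r s α v u (Sum.inr (Sum.inr i)) = v ^ α := by
  rw [whiskerSum, sum_whiskerGraph_right fun e => whiskerWeight r s v u e ^ α]
  simp

theorem weightSum_whiskerVector (x : Bool ⊕ (Fin r ⊕ Fin r)) :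
    weightSum (incidentEdges (whiskerGraph r r)) α (whiskerVector r v u) x =
      whiskerSum r r α v u x := by
  rw [whiskerVector_eq, weightSum_incidentEdges, whiskerSum]

theorem card_whisker (r : ℕ) :
    (Fintype.card (Bool ⊕ (Fin r ⊕ Fin r)) : ℝ) = 2 * (r + 1) := by
  simp
  ring

/-! ### Equilibrium equations on whisker graphs -/

variable {v u α}

/-- The weights solve the equilibrium equations of a graph with `n` vertices. -/
theorem whisker_balance {n : ℝ} (hv : 0 < v) (hrs : s = 0 ∨ s = r)
    (hu : n * u = u ^ α / (u ^ α + r * v ^ α) + u ^ α / (u ^ α + s * v ^ α))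
    (hvn : n * v = 1 + v ^ α / (u ^ α + r * v ^ α)) {a b : Bool ⊕ (Fin r ⊕ Fin s)}
    (h : (whiskerGraph r s).Adj a b) :
    n * whiskerWeight r s v u s(a, b) =
      whiskerWeight r s v u s(a, b) ^ α / whiskerSum r s α v u a +
        whiskerWeight r s v u s(a, b) ^ α / whiskerSum r s α v u b := by
  have hva := (Real.rpow_pos_of_pos hv α).ne'
  refine whiskerGraph_adj_cases (P := fun a b => n * whiskerWeight r s v u s(a, b) =
      whiskerWeight r s v u s(a, b) ^ α / whiskerSum r s α v u a +
        whiskerWeight r s v u s(a, b) ^ α / whiskerSum r s α v u b)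
    (fun a b h => ?_) ?_ (fun i => ?_) (fun i => ?_) h
  · rw [Sym2.eq_swap, h, add_comm]
  · simp [hu]
  · simp [hvn, div_self hva, add_comm]
  -- At the second centre either there are no leaves or, when s = r, the leaf equation is the one at
  -- the first centre.
  · rcases hrs with rfl | rfl
    · exact i.elim0
    · simp [hvn, div_self hva, add_comm]

theorem whiskerSum_pos (hv : 0 < v) (hu : 0 < u) (a : Bool ⊕ (Fin r ⊕ Fin s)) :
    0 < whiskerSum r s α v u a := by
  have hva := Real.rpow_pos_of_pos hv α
  have hua := Real.rpow_pos_of_pos hu α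
  rcases a with (_ | _) | i | i <;> simp <;> positivity

@[simp]
theorem whiskerVector_centre : whiskerVector r v u (centreEdge r r) = u := by
  simp [whiskerVector, centreEdge]

@[simp]
theorem whiskerVector_left (i : Fin r) : whiskerVector r v u (leftEdge i) = v := by
  simp [whiskerVector, leftEdge]

@[simp]
theorem whiskerVector_right (i : Fin r) : whiskerVector r v u (rightEdge i) = v := by
  simp [whiskerVector, rightEdge]

theorem sum_selProb_centre (F : Bool ⊕ (Fin r ⊕ Fin r) → ℝ) :
    ∑ x, selProb (incidentEdges (whiskerGraph r r)) α (whiskerVector r v u) x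
      (centreEdge r r) * F x =
      u ^ α / (u ^ α + r * v ^ α) * F (Sum.inl false) +
        u ^ α / (u ^ α + r * v ^ α) * F (Sum.inl true) := by
  rw [sum_selProb_edge (e := centreEdge r r) rfl]
  simp only [weightSum_whiskerVector, whiskerSum_false, whiskerSum_true, whiskerVector_centre]

theorem sum_selProb_left (i : Fin r) (F : Bool ⊕ (Fin r ⊕ Fin r) → ℝ) :
    ∑ x, selProb (incidentEdges (whiskerGraph r r)) α (whiskerVector r v u) x
      (leftEdge i) * F x =
      v ^ α / (u ^ α + r * v ^ α) * F (Sum.inl false) +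
        v ^ α / v ^ α * F (Sum.inr (Sum.inl i)) := by
  rw [sum_selProb_edge (e := leftEdge i) rfl]
  simp only [weightSum_whiskerVector, whiskerSum_false, whiskerSum_left, whiskerVector_left]

theorem sum_selProb_right (i : Fin r) (F : Bool ⊕ (Fin r ⊕ Fin r) → ℝ) :
    ∑ x, selProb (incidentEdges (whiskerGraph r r)) α (whiskerVector r v u) x
      (rightEdge i) * F x =
      v ^ α / (u ^ α + r * v ^ α) * F (Sum.inl true) +
        v ^ α / v ^ α * F (Sum.inr (Sum.inr i)) := by
  rw [sum_selProb_edge (e := rightEdge i) rfl]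
  simp only [weightSum_whiskerVector, whiskerSum_true, whiskerSum_right, whiskerVector_right]

/-- The equations satisfied by a symmetric equilibrium. -/
theorem whisker_equations (hr : 1 ≤ r) (hv : 0 < v)
    (h : IsEquilibrium (graphLaw (whiskerGraph r r)) α (whiskerVector r v u)) :
    2 * (r + 1) * u = 2 * (u ^ α / (u ^ α + r * v ^ α)) ∧
      2 * (r + 1) * v = 1 + v ^ α / (u ^ α + r * v ^ α) := by
  rw [graphLaw_eq_incLaw] at h
  have hn : (2 * ((r : ℝ) + 1)) ≠ 0 := by positivity
  have h1 := h.eq_sum_selProb (centreEdge r r)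
  have h2 := h.eq_sum_selProb (leftEdge ⟨0, hr⟩)
  have h3 := sum_selProb_centre (r := r) (α := α) (v := v) (u := u) 1
  have h4 := sum_selProb_left (r := r) (α := α) (v := v) (u := u) ⟨0, hr⟩ 1
  rw [div_self (Real.rpow_pos_of_pos hv α).ne'] at h4
  simp only [Pi.one_apply, mul_one] at h3 h4
  rw [h3, card_whisker, whiskerVector_centre, eq_div_iff hn] at h1
  rw [h4, card_whisker, whiskerVector_left, eq_div_iff hn] at h2
  constructor <;> linarith

theorem isEquilibrium_whisker (hv : 0 < v) (hu : 0 < u)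
    (h1 : 2 * (r + 1) * u = 2 * (u ^ α / (u ^ α + r * v ^ α)))
    (h2 : 2 * (r + 1) * v = 1 + v ^ α / (u ^ α + r * v ^ α)) :
    IsEquilibrium (incLaw (incidentEdges (whiskerGraph r r))) α (whiskerVector r v u) := by
  have hn : (2 * ((r : ℝ) + 1)) ≠ 0 := by positivity
  have hva := (Real.rpow_pos_of_pos hv α).ne'
  refine isEquilibrium_incLaw (fun e => ?_) (fun x => ?_) fun e => ?_
  · unfold whiskerVector
    split_ifs
    exacts [hu.le, hv.le]
  · rw [weightSum_whiskerVector]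
    exact (whiskerSum_pos hv hu x).ne'
  · rw [card_whisker, eq_div_iff hn]
    refine whiskerGraph_edge_cases (P := fun e => whiskerVector r v u e * (2 * (r + 1)) =
      ∑ x, selProb (incidentEdges (whiskerGraph r r)) α (whiskerVector r v u) x e)
      ?_ (fun i => ?_) (fun i => ?_) e
    · have h3 := sum_selProb_centre (r := r) (α := α) (v := v) (u := u) 1
      simp only [Pi.one_apply, mul_one] at h3
      rw [h3, whiskerVector_centre]
      linarith
    · have h3 := sum_selProb_left (r := r) (α := α) (v := v) (u := u) i 1
      simp only [Pi.one_apply, mul_one, div_self hva] at h3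
      rw [h3, whiskerVector_left]
      linarith
    · have h3 := sum_selProb_right (r := r) (α := α) (v := v) (u := u) i 1
      simp only [Pi.one_apply, mul_one, div_self hva] at h3
      rw [h3, whiskerVector_right]
      linarith

/-- In an equilibrium the leaf edges carry mass. -/
theorem whisker_leaf_pos (hr : 1 ≤ r) (hα : 1 < α)
    (h : IsEquilibrium (graphLaw (whiskerGraph r r)) α (whiskerVector r v u)) : 0 < v := by
  have hv : 0 ≤ v := by simpa using h.1.1 (leftEdge ⟨0, hr⟩)
  refine hv.lt_of_ne fun h0 => ?_
  subst h0
  have hsum := h.1.2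
  rw [Finset.sum_eq_single (centreEdge r r), whiskerVector_centre] at hsum
  · rw [graphLaw_eq_incLaw] at h
    have h1 := h.eq_sum_selProb (centreEdge r r)
    have h3 := sum_selProb_centre (r := r) (α := α) (v := 0) (u := u) 1
    simp only [Pi.one_apply, mul_one] at h3
    have hr' : (1 : ℝ) ≤ r := by exact_mod_cast hr
    -- With empty leaf edges all mass is on the central edge, whose equation becomes 2(r + 1) = 2,
    -- contradicting r ≥ 1.
    rw [h3, card_whisker, whiskerVector_centre, hsum, Real.one_rpow,
      Real.zero_rpow (by linarith), eq_div_iff (by positivity)] at h1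
    norm_num at h1
    linarith
  · intro e _
    refine whiskerGraph_edge_cases (P := fun e => e ≠ centreEdge r r →
      whiskerVector r 0 u e = 0) ?_ ?_ ?_ e
    · simp
    · simp
    · simp
  · simp

/-- The symmetric equilibria in terms of the quotient `t = v / u`. -/
theorem whiskerVector_mem_equilibria_iff (hr : 1 ≤ r) (hα : 1 < α) (hu : 0 < u) :
    whiskerVector r v u ∈ equilibria (whiskerGraph r r) α ↔
      ∃ t, 0 < t ∧ ratioFun (r + 1) α t = 0 ∧ u = 1 / (1 + 2 * r * t) ∧
        v = t / (1 + 2 * r * t) := by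
  have hr' : (1 : ℝ) ≤ r := by exact_mod_cast hr
  constructor
  · intro h
    have hv := whisker_leaf_pos hr hα h
    obtain ⟨h1, h2⟩ := whisker_equations hr hv h
    have hua := Real.rpow_pos_of_pos hu α
    have hva := Real.rpow_pos_of_pos hv α
    have ht : (v / u) ^ α = v ^ α / u ^ α := Real.div_rpow hv.le hu.le α
    have hS : 0 < u ^ α + r * v ^ α := by positivity
    have huS : (r + 1) * u * (u ^ α + r * v ^ α) = u ^ α := by
      field_simp at h1
      linarith
    have hvS : 2 * (r + 1) * v * (u ^ α + r * v ^ α) = u ^ α + r * v ^ α + v ^ α := by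
      field_simp at h2
      linarith
    have hsum : 1 + 2 * r * (v / u) = 1 / u := by
      have : u + 2 * r * v = 1 := by
        have h3 : (r + 1) * (u ^ α + r * v ^ α) * (u + 2 * r * v) =
            (r + 1) * (u ^ α + r * v ^ α) * 1 := by
          linear_combination huS + r * hvS
        exact mul_left_cancel₀ (by positivity) h3
      field_simp
      linarith
    refine ⟨v / u, by positivity, ?_, ?_, ?_⟩
    -- This is `ratioFun` at v/u multiplied by u^α · u.
    · have hx : (r + 1) * v ^ α * u - 2 * v * u ^ α + u ^ α * u = 0 := by
        have h3 : (r + 1) * (u ^ α + r * v ^ α) *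
            ((r + 1) * v ^ α * u - 2 * v * u ^ α + u ^ α * u) = 0 := by
          linear_combination ((r + 1) * v ^ α + u ^ α) * huS - u ^ α * hvS
        exact (mul_eq_zero.mp h3).resolve_left (by positivity)
      unfold ratioFun
      rw [ht]
      field_simp
      linarith
    · rw [hsum, one_div_one_div]
    · rw [hsum]
      field_simp
  · rintro ⟨t, ht, h0, rfl, rfl⟩
    have hD : 0 < 1 + 2 * r * t := by positivity
    have hDa := Real.rpow_pos_of_pos hD α
    have hta := Real.rpow_pos_of_pos ht α
    unfold ratioFun at h0
    -- A rewriting of the ratio equation: it identifies the normalisation of total mass with the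
    -- denominator of the selection probabilities.
    have hd : (r + 1) * (1 + r * t ^ α) = 1 + 2 * r * t := by linear_combination r * h0
    rw [equilibria, Set.mem_ofPred_eq, graphLaw_eq_incLaw]
    refine isEquilibrium_whisker (by positivity) (by positivity) ?_ ?_
    · rw [Real.div_rpow ht.le hD.le, Real.div_rpow zero_le_one hD.le, Real.one_rpow, ← hd]
      field_simp
    · rw [Real.div_rpow ht.le hD.le, Real.div_rpow zero_le_one hD.le, Real.one_rpow]
      have h4 : 1 + t ^ α / (1 + r * t ^ α) = 2 * (r + 1) * (t / (1 + 2 * r * t)) := by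
        rw [← hd]
        field_simp
        linarith
      rw [← h4]
      field_simp

end Whisker

/-! ### Linear stability on whisker graphs -/

section WhiskerStability

open Classical

variable {r : ℕ} {α v u : ℝ}

theorem exists_extend_edgeSet {V : Type*} {G : SimpleGraph V} (y : G.edgeSet → ℝ) :
    ∃ z : Sym2 V → ℝ, y = fun e => z e.1 :=
  ⟨fun e => if h : e ∈ G.edgeSet then y ⟨e, h⟩ else 0, by ext e; simp⟩

theorem selMean_whiskerVector (z : Sym2 (Bool ⊕ (Fin r ⊕ Fin r)) → ℝ)
    (x : Bool ⊕ (Fin r ⊕ Fin r)) :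
    selMean (incidentEdges (whiskerGraph r r)) α (whiskerVector r v u) x (fun e => z e.1) =
      ∑ b, if (whiskerGraph r r).Adj x b then
        (fun e => whiskerWeight r r v u e ^ α / whiskerSum r r α v u x * z e) s(x, b) else 0 := by
  rw [← weightSum_whiskerVector, whiskerVector_eq, selMean_incidentEdges]

theorem selMean_whiskerVector_false (y : (whiskerGraph r r).edgeSet → ℝ) :
    selMean (incidentEdges (whiskerGraph r r)) α (whiskerVector r v u) (Sum.inl false) y =
      u ^ α / (u ^ α + r * v ^ α) * y (centreEdge r r) +
        v ^ α / (u ^ α + r * v ^ α) * ∑ i, y (leftEdge i) := by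
  obtain ⟨z, rfl⟩ := exists_extend_edgeSet y
  rw [selMean_whiskerVector]
  refine (sum_whiskerGraph_false (fun e => whiskerWeight r r v u e ^ α /
    whiskerSum r r α v u (Sum.inl false) * z e)).trans ?_
  simp [Finset.mul_sum, centreEdge, leftEdge]

theorem selMean_whiskerVector_true (y : (whiskerGraph r r).edgeSet → ℝ) :
    selMean (incidentEdges (whiskerGraph r r)) α (whiskerVector r v u) (Sum.inl true) y =
      u ^ α / (u ^ α + r * v ^ α) * y (centreEdge r r) +
        v ^ α / (u ^ α + r * v ^ α) * ∑ i, y (rightEdge i) := by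
  obtain ⟨z, rfl⟩ := exists_extend_edgeSet y
  rw [selMean_whiskerVector]
  refine (sum_whiskerGraph_true (fun e => whiskerWeight r r v u e ^ α /
    whiskerSum r r α v u (Sum.inl true) * z e)).trans ?_
  simp [Finset.mul_sum, centreEdge, rightEdge]

theorem selMean_whiskerVector_left (hv : 0 < v) (y : (whiskerGraph r r).edgeSet → ℝ)
    (i : Fin r) :
    selMean (incidentEdges (whiskerGraph r r)) α (whiskerVector r v u) (Sum.inr (Sum.inl i)) y =
      y (leftEdge i) := by
  obtain ⟨z, rfl⟩ := exists_extend_edgeSet y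
  rw [selMean_whiskerVector]
  refine (sum_whiskerGraph_left (fun e => whiskerWeight r r v u e ^ α /
    whiskerSum r r α v u (Sum.inr (Sum.inl i)) * z e) i).trans ?_
  simp [leftEdge, (Real.rpow_pos_of_pos hv α).ne']

theorem selMean_whiskerVector_right (hv : 0 < v) (y : (whiskerGraph r r).edgeSet → ℝ)
    (i : Fin r) :
    selMean (incidentEdges (whiskerGraph r r)) α (whiskerVector r v u) (Sum.inr (Sum.inr i)) y =
      y (rightEdge i) := by
  obtain ⟨z, rfl⟩ := exists_extend_edgeSet y
  rw [selMean_whiskerVector]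
  refine (sum_whiskerGraph_right (fun e => whiskerWeight r r v u e ^ α /
    whiskerSum r r α v u (Sum.inr (Sum.inr i)) * z e) i).trans ?_
  simp [rightEdge, (Real.rpow_pos_of_pos hv α).ne']

/-- Here c, a, b are the values of y on the central edge and on the two sets of leaf edges, and p is
the probability of one leaf edge at a centre. Splitting a and b into means m, l and deviations, r +
1 times the difference of the two sides is an explicit sum of squares: r(1 + p)m + (1 - rp)c and its
analogue with l, weighted by θ, plus the nonnegative deviations. The leaf vertices have zero
variance but contribute to the second moment on the right. -/
theorem whisker_variance_le {p θ : ℝ} (hr : 1 ≤ r) (hα : 0 ≤ α) (hp : 0 ≤ p) (hθ0 : 0 ≤ θ)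
    (hθ : θ * (1 + p) = α * p * (r + 1)) (a b : Fin r → ℝ) (c : ℝ) :
    α * (((1 - r * p) * c ^ 2 + p * ∑ i, a i ^ 2 - ((1 - r * p) * c + p * ∑ i, a i) ^ 2) +
      ((1 - r * p) * c ^ 2 + p * ∑ i, b i ^ 2 - ((1 - r * p) * c + p * ∑ i, b i) ^ 2)) ≤
    θ * ((1 - r * p) * c ^ 2 + p * ∑ i, a i ^ 2 + ((1 - r * p) * c ^ 2 + p * ∑ i, b i ^ 2) +
      (∑ i, a i ^ 2 + ∑ i, b i ^ 2)) := by
  have hr0 : (0 : ℝ) < r := by exact_mod_cast hr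
  have ha : (∑ i, a i) ^ 2 ≤ r * ∑ i, a i ^ 2 := by
    simpa using sq_sum_le_card_mul_sum_sq (s := Finset.univ) (f := a)
  have hb : (∑ i, b i) ^ 2 ≤ r * ∑ i, b i ^ 2 := by
    simpa using sq_sum_le_card_mul_sum_sq (s := Finset.univ) (f := b)
  generalize ∑ i, a i ^ 2 = Q at *
  generalize ∑ i, b i ^ 2 = R at *
  obtain ⟨m, hm⟩ : ∃ m, ∑ i, a i = r * m := ⟨(∑ i, a i) / r, by field_simp⟩
  obtain ⟨l, hl⟩ : ∃ l, ∑ i, b i = r * l := ⟨(∑ i, b i) / r, by field_simp⟩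
  rw [hm] at ha ⊢
  rw [hl] at hb ⊢
  have h1 : 0 ≤ Q - r * m ^ 2 := by nlinarith
  have h2 : 0 ≤ R - r * l ^ 2 := by nlinarith
  have h3 : 0 ≤ θ * ((r * (1 + p) * m + (1 - r * p) * c) ^ 2 +
      (r * (1 + p) * l + (1 - r * p) * c) ^ 2) := by positivity
  have h4 : 0 ≤ (r + 1) * (α * p * r * ((Q - r * m ^ 2) + (R - r * l ^ 2))) := by positivity
  rw [← sub_nonneg]
  have h5 : 0 < (r : ℝ) + 1 := by linarith
  refine nonneg_of_mul_nonneg_right (a := (r : ℝ) + 1) ?_ h5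
  refine (add_nonneg h3 h4).trans_eq ?_
  linear_combination (-(r * (1 - r * p) * ((m - c) ^ 2 + (l - c) ^ 2)) -
    (r + 1) * ((Q - r * m ^ 2) + (R - r * l ^ 2))) * hθ

variable {t : ℝ}

/-- The leaf probability at the centres. -/
theorem whisker_probs (hr : 1 ≤ r) (ht : 0 < t)
    (hv : v = t / (1 + 2 * r * t)) (hu : u = 1 / (1 + 2 * r * t)) :
    v ^ α / (u ^ α + r * v ^ α) = t ^ α / (1 + r * t ^ α) ∧
      u ^ α / (u ^ α + r * v ^ α) = 1 - r * (t ^ α / (1 + r * t ^ α)) := by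
  have hD : 0 < 1 + 2 * r * t := by positivity
  have hDa := Real.rpow_pos_of_pos hD α
  have hta := Real.rpow_pos_of_pos ht α
  rw [hv, hu, Real.div_rpow ht.le hD.le, Real.div_rpow zero_le_one hD.le, Real.one_rpow]
  constructor
  · field_simp
  · field_simp
    ring

theorem isLinearlyStable_whisker (hr : 1 ≤ r) (hα : 1 < α) (ht : 0 < t)
    (h0 : ratioFun (r + 1) α t = 0) (htm : t < ratioMin (r + 1) α)
    (hv : v = t / (1 + 2 * r * t)) (hu : u = 1 / (1 + 2 * r * t)) :
    IsLinearlyStable (graphLaw (whiskerGraph r r)) α (whiskerVector r v u) := by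
  have hr' : (1 : ℝ) ≤ r := by exact_mod_cast hr
  have hD : 0 < 1 + 2 * r * t := by positivity
  have hu0 : 0 < u := by rw [hu]; positivity
  have hv0 : 0 < v := by rw [hv]; positivity
  have hta := Real.rpow_pos_of_pos ht α
  have heq := (whiskerVector_mem_equilibria_iff hr hα hu0).mpr ⟨t, ht, h0, hu, hv⟩
  rw [equilibria, Set.mem_ofPred_eq] at heq
  rw [graphLaw_eq_incLaw] at heq ⊢
  have hlt := (lt_ratioMin_iff (by linarith : (0 : ℝ) < r + 1) hα ht.le).mp htm
  obtain ⟨hp, hp0⟩ := whisker_probs (α := α) hr ht hv hu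
  have ht1 := Real.rpow_pos_of_pos ht (α - 1)
  refine isLinearlyStable_of_variance_le (θ := α * (r + 1) * t ^ (α - 1) / 2) hα
    (by positivity) (by linarith) heq
    (fun x => by rw [weightSum_whiskerVector]; exact (whiskerSum_pos hv0 hu0 x).ne')
    fun y => ?_
  -- The ratio equation gives 1 + p = 2t/(1 + r t^α), which makes the sharp constant αp(r + 1)/(1 +
  -- p) equal to α(r + 1)t^(α-1)/2.
  have hθ : α * (r + 1) * t ^ (α - 1) / 2 * (1 + t ^ α / (1 + r * t ^ α)) =
      α * (t ^ α / (1 + r * t ^ α)) * (r + 1) := by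
    have h1 := rpow_sub_one_mul_self hα ht.le
    unfold ratioFun at h0
    field_simp
    linear_combination t ^ (α - 1) * h0 + 2 * h1
  have := whisker_variance_le hr (by linarith : 0 ≤ α)
    (by positivity : 0 ≤ t ^ α / (1 + r * t ^ α)) (by positivity) hθ
    (fun i => y (leftEdge i)) (fun i => y (rightEdge i)) (y (centreEdge r r))
  simp only [Fintype.sum_sum_type, Fintype.sum_bool, selMean_whiskerVector_false,
    selMean_whiskerVector_true, selMean_whiskerVector_left hv0,
    selMean_whiskerVector_right hv0, sub_self, Finset.sum_const_zero, add_zero, hp, hp0]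
  rw [add_comm] at this
  linarith

/-- The extremal case of the variance inequality gives an eigenvector for θ - 1, which is positive
on the increasing branch of `ratioFun`. -/
theorem not_isLinearlyStable_whisker (hr : 1 ≤ r) (hα : 1 < α) (ht : 0 < t)
    (h0 : ratioFun (r + 1) α t = 0) (htm : ratioMin (r + 1) α < t)
    (hv : v = t / (1 + 2 * r * t)) (hu : u = 1 / (1 + 2 * r * t)) :
    ¬ IsLinearlyStable (graphLaw (whiskerGraph r r)) α (whiskerVector r v u) := by
  rintro ⟨heq, D, hD, hneg⟩
  have hr' : (1 : ℝ) ≤ r := by exact_mod_cast hr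
  have hden : 0 < 1 + 2 * r * t := by positivity
  have hu0 : 0 < u := by rw [hu]; positivity
  have hv0 : 0 < v := by rw [hv]; positivity
  have hta := Real.rpow_pos_of_pos ht α
  have hgt := (ratioMin_lt_iff (by linarith : (0 : ℝ) < r + 1) hα ht.le).mp htm
  obtain ⟨hp, hp0⟩ := whisker_probs (α := α) hr ht hv hu
  have hS : ∀ x, weightSum (incidentEdges (whiskerGraph r r)) α (whiskerVector r v u) x ≠ 0 :=
    fun x => by rw [weightSum_whiskerVector]; exact (whiskerSum_pos hv0 hu0 x).ne'
  rw [graphLaw_eq_incLaw] at heq hD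
  have hnn : ∀ e, 0 ≤ whiskerVector r v u e := heq.1.1
  obtain rfl := hD.unique (hasJacobian_incJacobian hα.le hS)
  set θ := α * (r + 1) * t ^ (α - 1) / 2 with hθdef
  have hθ : θ * (1 + t ^ α / (1 + r * t ^ α)) =
      α * (t ^ α / (1 + r * t ^ α)) * (r + 1) := by
    have h1 := rpow_sub_one_mul_self hα ht.le
    unfold ratioFun at h0
    rw [hθdef]
    field_simp
    linear_combination t ^ (α - 1) * h0 + 2 * h1
  set p := t ^ α / (1 + r * t ^ α) with hpdef
  have hvn : 2 * (r + 1) * v = 1 + p := by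
    have := (whisker_equations hr hv0 (by rw [graphLaw_eq_incLaw]; exact heq)).2
    rwa [hp] at this
  have hun : (r + 1) * u = 1 - r * p := by
    have := (whisker_equations hr hv0 (by rw [graphLaw_eq_incLaw]; exact heq)).1
    rw [hp0] at this
    linarith
  have hsum : u + 2 * r * v = 1 := by
    rw [hv, hu]
    field_simp
  -- Mass moves between the central edge and all leaf edges equally; the central value makes the
  -- total change of mass zero.
  set y : (whiskerGraph r r).edgeSet → ℝ :=
    fun e => if e = centreEdge r r then -(2 * r * v / u) else 1 with hy
  have hyc : y (centreEdge r r) = -(2 * r * v / u) := by simp [hy]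
  have hyl : ∀ i, y (leftEdge i) = 1 := fun i => by
    simp [hy, Subtype.ext_iff, leftEdge, centreEdge]
  have hyr : ∀ i, y (rightEdge i) = 1 := fun i => by
    simp [hy, Subtype.ext_iff, rightEdge, centreEdge]
  have hmul := fun e => incJacobian_mulVec hα hnn hS y e
  rw [card_whisker] at hmul
  have hrow : ∀ e, (incJacobian (incidentEdges (whiskerGraph r r)) α
      (whiskerVector r v u)).mulVec (fun f => whiskerVector r v u f * y f) e =
      (θ - 1) * (whiskerVector r v u e * y e) := by
    have hva := (Real.rpow_pos_of_pos hv0 α).ne'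
    have hθv : 2 * θ * v = α * p := by
      have h5 : (r + 1 : ℝ) ≠ 0 := by positivity
      refine mul_left_cancel₀ h5 ?_
      linear_combination θ * hvn + hθ
    have hone : 1 + 2 * r * v / u = 1 / u := by
      field_simp
      linarith
    have hcoef : α / (2 * (r + 1)) * (p * (1 - r * p) / u) = θ * v := by
      rw [← hun]
      field_simp
      linarith
    refine whiskerGraph_edge_cases (P := fun e => (incJacobian (incidentEdges (whiskerGraph r r))
      α (whiskerVector r v u)).mulVec (fun f => whiskerVector r v u f * y f) e =
      (θ - 1) * (whiskerVector r v u e * y e)) ?_ (fun i => ?_) fun i => ?_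
    · rw [hmul, sum_selProb_centre]
      simp only [selMean_whiskerVector_false, selMean_whiskerVector_true, hp, hp0, hyc, hyl, hyr,
        whiskerVector_centre, Finset.sum_const, Finset.card_univ, Fintype.card_fin, nsmul_eq_mul,
        mul_one]
      have h6 : -(2 * r * v / u) - ((1 - r * p) * -(2 * r * v / u) + p * r) = -(r * p / u) := by
        linear_combination (-(r * p)) * hone
      rw [h6]
      have h7 : u * -(2 * r * v / u) = -(2 * r * v) := by field_simp
      rw [h7]
      linear_combination (-2 * r) * hcoef
    · rw [hmul, sum_selProb_left]
      simp only [selMean_whiskerVector_false, selMean_whiskerVector_left hv0, hp, hp0, hyc, hyl,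
        whiskerVector_left, Finset.sum_const, Finset.card_univ, Fintype.card_fin, nsmul_eq_mul,
        mul_one, sub_self, mul_zero, add_zero]
      have h6 : 1 - ((1 - r * p) * -(2 * r * v / u) + p * r) = (1 - r * p) / u := by
        linear_combination (1 - r * p) * hone
      rw [h6]
      linear_combination hcoef
    · rw [hmul, sum_selProb_right]
      simp only [selMean_whiskerVector_true, selMean_whiskerVector_right hv0, hp, hp0, hyc, hyr,
        whiskerVector_right, Finset.sum_const, Finset.card_univ, Fintype.card_fin, nsmul_eq_mul,
        mul_one, sub_self, mul_zero, add_zero]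
      have h6 : 1 - ((1 - r * p) * -(2 * r * v / u) + p * r) = (1 - r * p) / u := by
        linear_combination (1 - r * p) * hone
      rw [h6]
      linear_combination hcoef
  have hev := isEigenvalue_of_mulVec (fun h => by
    have := congrFun h (leftEdge ⟨0, hr⟩)
    simp [hyl] at this
    exact hv0.ne' this) hrow
  have := hneg _ hev
  rw [Complex.ofReal_re] at this
  linarith

end WhiskerStability

/-- The symmetric equilibria of the `(r, r)`-whisker graph. -/
theorem whisker_phase_transition {r : ℕ} (hr : 1 ≤ r) : ∃ a : ℝ, 1 < a ∧
    thresholdFun a = Real.log ((1 + (r : ℝ)) / 2) ∧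
    (∀ β : ℝ, 1 < β → thresholdFun β = Real.log ((1 + (r : ℝ)) / 2) → β = a) ∧
    (2 * (1 - 1 / a)) ^ (a - 1) = a / 2 * ((r : ℝ) + 1) ∧
    (∃ v u v' u' : ℝ → ℝ,
      (∀ α : ℝ, a < α →
        {q : ℝ × ℝ | 0 < q.2 ∧ whiskerVector r q.1 q.2 ∈
            equilibria (whiskerGraph r r) α} = {(v α, u α), (v' α, u' α)} ∧
        (v α, u α) ≠ (v' α, u' α) ∧
        v α < u α ∧ v' α < u' α ∧
        whiskerVector r (v α) (u α) ∈ stableEquilibria (whiskerGraph r r) α ∧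
        whiskerVector r (v' α) (u' α) ∉ stableEquilibria (whiskerGraph r r) α) ∧
      StrictMonoOn u (Set.Ioi a) ∧
      Tendsto u atTop (𝓝 (1 / ((r : ℝ) + 1)))) ∧
    (∀ α : ℝ, 1 < α → α < a → ∀ v u : ℝ, 0 < u →
      whiskerVector r v u ∉ equilibria (whiskerGraph r r) α) := by
  have hr' : (1 : ℝ) ≤ r := by exact_mod_cast hr
  have hc : (2 : ℝ) ≤ r + 1 := by linarith
  obtain ⟨a, ha2, hat, habove, hbelow⟩ := exists_threshold hc
  rw [add_comm (1 : ℝ)]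
  refine ⟨a, by linarith, hat, fun β hβ h => ?_,
    rpow_eq_of_thresholdFun_eq (by linarith) (by linarith) hat, ?_, fun α h1 hα v u hu h => ?_⟩
  · rcases lt_trichotomy β a with h' | h' | h'
    · exact absurd h (hbelow β hβ h').ne
    · exact h'
    · exact absurd h (habove β h').ne'
  -- Below the threshold the roots get the dummy value 0, so that choice yields functions on all of
  -- ℝ.
  · have hroots : ∀ α : ℝ, ∃ s t : ℝ, a < α → 0 < s ∧ s < ratioMin (r + 1) α ∧
        ratioMin (r + 1) α < t ∧ ratioFun (r + 1) α s = 0 ∧ ratioFun (r + 1) α t = 0 ∧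
        ∀ x, 0 < x → ratioFun (r + 1) α x = 0 → x = s ∨ x = t := by
      intro α
      by_cases hα : a < α
      · obtain ⟨s, t, h⟩ := exists_ratio_roots hc (by linarith) (habove α hα)
        exact ⟨s, t, fun _ => h⟩
      · exact ⟨0, 0, fun h => absurd h hα⟩
    choose s t hst using hroots
    have hD : ∀ x : ℝ, 0 < x → 0 < 1 + 2 * r * x := fun x hx => by positivity
    have hanti : StrictAntiOn s (Set.Ioi a) := fun α hα β hβ hαβ =>
      ratio_root_lt hc (by linarith [Set.mem_Ioi.mp hα]) hαβ (hst α hα).1 (hst α hα).2.2.2.1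
        (hst β hβ).1 (hst β hβ).2.1 (hst β hβ).2.2.2.1
    refine ⟨fun α => s α / (1 + 2 * r * s α), fun α => 1 / (1 + 2 * r * s α),
      fun α => t α / (1 + 2 * r * t α), fun α => 1 / (1 + 2 * r * t α), fun α hα => ?_, ?_, ?_⟩
    · have hα1 : 1 < α := by linarith
      obtain ⟨hs0, hsm, htm, hs, ht, huniq⟩ := hst α hα
      have ht0 : 0 < t α := by linarith
      have hDs := hD _ hs0
      have hDt := hD _ ht0
      have hs1 := lt_one_of_ratioFun_eq_zero hc hα1 hs
      have ht1 := lt_one_of_ratioFun_eq_zero hc hα1 ht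
      refine ⟨?_, ?_, ?_, ?_, ?_, ?_⟩
      · ext ⟨v, u⟩
        simp only [Set.mem_ofPred_eq, Set.mem_insert_iff, Set.mem_singleton_iff, Prod.mk.injEq]
        constructor
        · rintro ⟨hu, h⟩
          obtain ⟨x, hx, hx0, rfl, rfl⟩ := (whiskerVector_mem_equilibria_iff hr hα1 hu).mp h
          rcases huniq x hx hx0 with rfl | rfl <;> simp
        · rintro (⟨rfl, rfl⟩ | ⟨rfl, rfl⟩)
          · have hu : 0 < 1 / (1 + 2 * r * s α) := by positivity
            exact ⟨hu, (whiskerVector_mem_equilibria_iff hr hα1 hu).mpr ⟨_, hs0, hs, rfl, rfl⟩⟩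
          · have hu : 0 < 1 / (1 + 2 * r * t α) := by positivity
            exact ⟨hu, (whiskerVector_mem_equilibria_iff hr hα1 hu).mpr ⟨_, ht0, ht, rfl, rfl⟩⟩
      · intro h
        have h1 : 1 / (1 + 2 * r * s α) = 1 / (1 + 2 * r * t α) := (Prod.mk.inj h).2
        have h2 : 1 / (1 + 2 * r * t α) < 1 / (1 + 2 * r * s α) :=
          one_div_lt_one_div_of_lt hDs (by nlinarith)
        linarith
      · exact div_lt_div_of_pos_right hs1 hDs
      · exact div_lt_div_of_pos_right ht1 hDt
      · exact isLinearlyStable_whisker hr hα1 hs0 hs hsm rfl rfl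
      · exact not_isLinearlyStable_whisker hr hα1 ht0 ht htm rfl rfl
    · intro α hα β hβ hαβ
      have h1 := hanti hα hβ hαβ
      exact one_div_lt_one_div_of_lt (hD _ (hst β hβ).1) (by nlinarith)
    · have h1 := tendsto_ratio_root hc (by linarith : 1 < a) (fun α hα => (hst α hα).1)
        (fun α hα => (hst α hα).2.2.2.1) hanti
      have h2 := ((h1.const_mul (2 * (r : ℝ))).const_add 1)
      have h3 : 1 + 2 * (r : ℝ) * (1 / 2) = r + 1 := by ring
      rw [h3] at h2
      simpa only [one_div] using h2.inv₀ (by positivity)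
  · obtain ⟨t, ht, h0, -⟩ := (whiskerVector_mem_equilibria_iff hr h1 hu).mp h
    exact (ratioFun_pos (by linarith) h1 (hbelow α h1 hα) ht.le).ne' h0

/-! ### Stable allocations on whisker-forests -/

section Forest

open Classical

/-- A star with `r + 1` edges is a whisker graph without leaves at the second centre. -/
def starIso (r : ℕ) : completeBipartiteGraph Unit (Fin (r + 1)) ≃g whiskerGraph r 0 where
  toFun x := match x with
    | Sum.inl _ => Sum.inl false
    | Sum.inr i => Fin.cases (Sum.inl true) (fun i => Sum.inr (Sum.inl i)) i
  invFun x := match x with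
    | Sum.inl false => Sum.inl ()
    | Sum.inl true => Sum.inr 0
    | Sum.inr (Sum.inl i) => Sum.inr i.succ
    | Sum.inr (Sum.inr i) => i.elim0
  left_inv x := by
    rcases x with _ | i
    · rfl
    · induction i using Fin.cases <;> rfl
  right_inv x := by
    rcases x with (_ | _) | i | i
    · rfl
    · rfl
    · rfl
    · exact i.elim0
  map_rel_iff' {x y} := by
    rcases x with _ | i <;> rcases y with _ | j
    · simp [whiskerGraph]
    · induction j using Fin.cases <;> simp [whiskerGraph]
    · induction i using Fin.cases <;> simp [whiskerGraph]
    · induction i using Fin.cases <;> induction j using Fin.cases <;> simp [whiskerGraph]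

theorem exists_whiskerGraph_iso {W : Type*} {H : SimpleGraph W}
    (h : IsStar H ∨ IsSymmetricWhisker H) :
    ∃ r s : ℕ, (s = 0 ∨ s = r) ∧ Nonempty (whiskerGraph r s ≃g H) := by
  rcases h with ⟨m, hm, ⟨f⟩⟩ | ⟨r, -, hf⟩
  · obtain ⟨r, rfl⟩ := Nat.exists_eq_add_of_le' hm
    exact ⟨r, 0, Or.inl rfl, ⟨(starIso r).symm.trans f⟩⟩
  · exact ⟨r, r, Or.inr rfl, hf⟩

/-- As α → ∞ the equation tends to 2t = 1. At t = 1/2 the power terms make the left side too small;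
at t = 3/4 the gain 2t - 1 = 1/2 outweighs them. Only existence and a bound away from 1 are needed.
-/
theorem exists_whisker_ratio {r s : ℕ} (hrs : s = 0 ∨ s = r) {α : ℝ} (hα : 1 < α)
    (hsmall : (r + 1) * (3 / 4 : ℝ) ^ α < 1 / 2) :
    ∃ t : ℝ, 1 / 2 ≤ t ∧ t ≤ 3 / 4 ∧
      t * ((1 + r * t ^ α) + (1 + s * t ^ α)) = (1 + (r + 1) * t ^ α) * (1 + s * t ^ α) := by
  have hpow : Continuous fun t : ℝ => t ^ α := Real.continuous_rpow_const (by linarith)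
  have hcont : Continuous fun t : ℝ => t * ((1 + r * t ^ α) + (1 + s * t ^ α)) -
      (1 + (r + 1) * t ^ α) * (1 + s * t ^ α) := by fun_prop
  have hl : 0 < (1 / 2 : ℝ) ^ α := by positivity
  have hu : 0 < (3 / 4 : ℝ) ^ α := by positivity
  have hr : (0 : ℝ) ≤ r := Nat.cast_nonneg r
  obtain ⟨t, ht, h⟩ := intermediate_value_Icc (by norm_num : (1 / 2 : ℝ) ≤ 3 / 4)
    hcont.continuousOn (show (0 : ℝ) ∈ Set.Icc _ _ by
      generalize (1 / 2 : ℝ) ^ α = x at *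
      generalize (3 / 4 : ℝ) ^ α = y at *
      have h1 : 0 ≤ r * x := by positivity
      have h2 : 0 ≤ r * y := by positivity
      rcases hrs with rfl | rfl
      · constructor
        · push_cast
          linarith
        · push_cast
          linarith
      · constructor
        · nlinarith
        · nlinarith)
  exact ⟨t, ht.1, ht.2, by simpa [sub_eq_zero] using h⟩

theorem exists_whisker_weights {r s : ℕ} (hrs : s = 0 ∨ s = r) {α n : ℝ} (hα : 1 < α)
    (hn : 0 < n) (hsmall : (r + 1) * (3 / 4 : ℝ) ^ α < 1 / 2) :
    ∃ v u : ℝ, 0 < v ∧ 0 < u ∧ 1 ≤ n * v ∧ 1 ≤ n * u ∧ v ≤ 3 / 4 * u ∧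
      n * u = u ^ α / (u ^ α + r * v ^ α) + u ^ α / (u ^ α + s * v ^ α) ∧
      n * v = 1 + v ^ α / (u ^ α + r * v ^ α) := by
  obtain ⟨t, ht1, ht2, ht⟩ := exists_whisker_ratio hrs hα hsmall
  have ht0 : 0 < t := by linarith
  have hT := Real.rpow_pos_of_pos ht0 α
  set q := 1 + r * t ^ α with hq
  set q' := 1 + s * t ^ α with hq'
  have hq0 : 0 < q := by positivity
  have hq0' : 0 < q' := by positivity
  -- The equation for the central edge defines u; the ratio equation is then exactly the leaf
  -- equation for v = t u.
  set u := (1 / q + 1 / q') / n with hu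
  have hu0 : 0 < u := by positivity
  have hnu : n * u = 1 / q + 1 / q' := by rw [hu]; field_simp
  have hnv : n * (t * u) = 1 + t ^ α / q := by
    rw [mul_left_comm, hnu]
    have h1 : t * (q + q') = (q + t ^ α) * q' := by rw [ht]; ring
    field_simp
    linarith
  have hua := Real.rpow_pos_of_pos hu0 α
  have hva : (t * u) ^ α = t ^ α * u ^ α := Real.mul_rpow ht0.le hu0.le
  have h1v : 1 ≤ n * (t * u) := by
    rw [hnv]
    have : 0 ≤ t ^ α / q := by positivity
    linarith
  refine ⟨t * u, u, by positivity, hu0, h1v, ?_, by nlinarith, ?_, ?_⟩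
  · have : 0 < n * u := by positivity
    nlinarith
  · rw [hnu, hva]
    have h2 : u ^ α + r * (t ^ α * u ^ α) = u ^ α * q := by rw [hq]; ring
    have h3 : u ^ α + s * (t ^ α * u ^ α) = u ^ α * q' := by rw [hq']; ring
    rw [h2, h3]
    field_simp
  · rw [hnv, hva]
    have h2 : u ^ α + r * (t ^ α * u ^ α) = u ^ α * q := by rw [hq]; ring
    rw [h2]
    field_simp

/-- Every vertex has a neighbour whose edge dominates all other edges at the vertex. -/
theorem whisker_dominant {r s : ℕ} {α v u ε : ℝ} (hv : 0 < v) (hu : 0 < u)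
    (hε : (v / u) ^ α ≤ ε) (a : Bool ⊕ (Fin r ⊕ Fin s)) :
    ∃ b, (whiskerGraph r s).Adj a b ∧ ∀ b', (whiskerGraph r s).Adj a b' → b' ≠ b →
      whiskerWeight r s v u s(a, b') ^ α / whiskerSum r s α v u a ≤ ε := by
  have hva := Real.rpow_pos_of_pos hv α
  have hua := Real.rpow_pos_of_pos hu α
  rw [Real.div_rpow hv.le hu.le] at hε
  have hcentre : ∀ m : ℕ, v ^ α / (u ^ α + m * v ^ α) ≤ ε := fun m =>
    (div_le_div_of_nonneg_left hva.le hua (le_add_of_nonneg_right (by positivity))).trans hε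
  rcases a with (_ | _) | i | i
  · refine ⟨_, whiskerGraph_adj_centres r s, fun b hb hne => ?_⟩
    rcases b with (_ | _) | j | j
    · simp at hb
    · exact absurd rfl hne
    · simpa using hcentre r
    · simp [whiskerGraph] at hb
  · refine ⟨_, (whiskerGraph_adj_centres r s).symm, fun b hb hne => ?_⟩
    rcases b with (_ | _) | j | j
    · exact absurd rfl hne
    · simp at hb
    · simp [whiskerGraph] at hb
    · simpa using hcentre s
  · refine ⟨_, (whiskerGraph_adj_left i).symm, fun b hb hne => ?_⟩
    rcases b with (_ | _) | j | j
    · exact absurd rfl hne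
    all_goals simp [whiskerGraph] at hb
  · refine ⟨_, (whiskerGraph_adj_right i).symm, fun b hb hne => ?_⟩
    rcases b with (_ | _) | j | j
    · simp [whiskerGraph] at hb
    · exact absurd rfl hne
    all_goals simp [whiskerGraph] at hb

variable {V : Type*} {G : SimpleGraph V} {k : ℕ} {H : Fin k → G.Subgraph}
  {r s : Fin k → ℕ} (φ : ∀ j, whiskerGraph (r j) (s j) ≃g (H j).coe) (v u : Fin k → ℝ)

/-- The weights of the clusters, put together and extended by zero. -/
def forestWeight (e : Sym2 V) : ℝ :=
  ∑ j, if e ∈ (H j).edgeSet then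
    (if e = s((φ j (Sum.inl false) : V), (φ j (Sum.inl true) : V)) then u j else v j) else 0

variable {φ v u}

theorem forestWeight_eq_zero {e : Sym2 V} (h : ∀ j, e ∉ (H j).edgeSet) :
    forestWeight φ v u e = 0 :=
  Finset.sum_eq_zero fun j _ => if_neg (h j)

theorem cluster_adj_iff {j : Fin k} {a b : Bool ⊕ (Fin (r j) ⊕ Fin (s j))} :
    (H j).Adj (φ j a) (φ j b) ↔ (whiskerGraph (r j) (s j)).Adj a b :=
  (φ j).map_rel_iff

theorem cluster_injective (j : Fin k) : Function.Injective fun a => (φ j a : V) :=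
  Subtype.val_injective.comp (φ j).injective

theorem exists_of_cluster_adj {j : Fin k} {x y : V} (h : (H j).Adj x y) :
    ∃ a b, x = φ j a ∧ y = φ j b ∧ (whiskerGraph (r j) (s j)).Adj a b := by
  obtain ⟨a, ha⟩ := (φ j).surjective ⟨x, h.fst_mem⟩
  obtain ⟨b, hb⟩ := (φ j).surjective ⟨y, h.snd_mem⟩
  refine ⟨a, b, by rw [ha], by rw [hb], ?_⟩
  rw [← cluster_adj_iff (φ := φ), ha, hb]
  exact h

theorem not_mem_edgeSet_of_ne
    (hdisj : ∀ i j, i ≠ j → Disjoint (H i).verts (H j).verts)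
    {i j : Fin k} (hij : i ≠ j) (a : Bool ⊕ (Fin (r j) ⊕ Fin (s j)))
    (w : V) : s((φ j a : V), w) ∉ (H i).edgeSet := by
  intro h
  have h1 : (H i).Adj (φ j a) w := h
  exact Set.disjoint_left.mp (hdisj i j hij) h1.fst_mem (φ j a).2

/-- Disjoint clusters share no edge, so at most one term of the sum survives. -/
theorem forestWeight_cluster
    (hdisj : ∀ i j, i ≠ j → Disjoint (H i).verts (H j).verts)
    {j : Fin k} {a b : Bool ⊕ (Fin (r j) ⊕ Fin (s j))}
    (h : (whiskerGraph (r j) (s j)).Adj a b) :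
    forestWeight φ v u s((φ j a : V), (φ j b : V)) =
      whiskerWeight (r j) (s j) (v j) (u j) s(a, b) := by
  unfold forestWeight
  rw [Finset.sum_eq_single j]
  · have h1 : s((φ j a : V), (φ j b : V)) ∈ (H j).edgeSet := cluster_adj_iff.mpr h
    rw [if_pos h1]
    unfold whiskerWeight
    have h2 : s((φ j a : V), (φ j b : V)) =
        s((φ j (Sum.inl false) : V), (φ j (Sum.inl true) : V)) ↔
        s(a, b) = s(Sum.inl false, Sum.inl true) :=
      (Sym2.map.injective (cluster_injective (φ := φ) j)).eq_iff
        (a := s(a, b)) (b := s(Sum.inl false, Sum.inl true))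
    simp only [h2]
  · intro i _ hij
    exact if_neg (not_mem_edgeSet_of_ne hdisj hij a _)
  · simp

theorem forestWeight_eq_zero_of_not_adj
    (hdisj : ∀ i j, i ≠ j → Disjoint (H i).verts (H j).verts)
    {j : Fin k} {a : Bool ⊕ (Fin (r j) ⊕ Fin (s j))}
    {w : V} (h : ¬ (H j).Adj (φ j a) w) : forestWeight φ v u s((φ j a : V), w) = 0 := by
  refine forestWeight_eq_zero fun i hi => ?_
  by_cases hij : i = j
  · subst hij
    exact h hi
  · exact not_mem_edgeSet_of_ne hdisj hij a w hi

/-- Edges leaving the cluster, and chords of G inside it, have weight zero, and 0^α = 0; each vertex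
sees only its own cluster. -/
theorem weightSum_forestWeight [Fintype V]
    (hdisj : ∀ i j, i ≠ j → Disjoint (H i).verts (H j).verts)
    {α : ℝ} (hα : α ≠ 0) {j : Fin k}
    (a : Bool ⊕ (Fin (r j) ⊕ Fin (s j))) :
    weightSum (incidentEdges G) α (fun e => forestWeight φ v u e.1) (φ j a) =
      whiskerSum (r j) (s j) α (v j) (u j) a := by
  rw [weightSum_incidentEdges, whiskerSum]
  symm
  refine Finset.sum_of_injOn (fun b => (φ j b : V)) (cluster_injective j).injOn (by simp)
    (fun w _ hw => ?_) fun b _ => ?_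
  · have h : ¬ (H j).Adj (φ j a) w := fun h => by
      obtain ⟨-, b, -, hb, -⟩ := exists_of_cluster_adj (φ := φ) h
      exact hw ⟨b, by simp, hb.symm⟩
    rw [forestWeight_eq_zero_of_not_adj hdisj h, Real.zero_rpow hα, ite_self]
  · by_cases h : (whiskerGraph (r j) (s j)).Adj a b
    · have h1 : (H j).Adj (φ j a) (φ j b) := cluster_adj_iff.mpr h
      rw [if_pos h, if_pos h1.adj_sub, forestWeight_cluster hdisj h]
    · rw [if_neg h, forestWeight_eq_zero_of_not_adj hdisj (by rwa [cluster_adj_iff]),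
        Real.zero_rpow hα, ite_self]


/-- Clusters with dominant edges combine to a linearly stable equilibrium. -/
theorem isLinearlyStable_forestWeight [Fintype V] [Nonempty V] {α ε : ℝ} (hα : 1 < α) (hε0 : 0 ≤ ε)
    (hε : 4 * α * ε * (Fintype.card V * Fintype.card G.edgeSet) < 1)
    (hcover : ⋃ j, (H j).verts = Set.univ)
    (hdisj : ∀ i j, i ≠ j → Disjoint (H i).verts (H j).verts)
    (hrs : ∀ j, s j = 0 ∨ s j = r j) (hv : ∀ j, 0 < v j) (hu : ∀ j, 0 < u j)
    (hv1 : ∀ j, 1 ≤ Fintype.card V * v j) (hu1 : ∀ j, 1 ≤ Fintype.card V * u j)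
    (hvu : ∀ j, (v j / u j) ^ α ≤ ε)
    (hequ : ∀ j, Fintype.card V * u j = u j ^ α / (u j ^ α + r j * v j ^ α) +
      u j ^ α / (u j ^ α + s j * v j ^ α))
    (heqv : ∀ j, Fintype.card V * v j = 1 + v j ^ α / (u j ^ α + r j * v j ^ α)) :
    IsLinearlyStable (graphLaw G) α fun e => forestWeight φ v u e.1 := by
  have hα0 : α ≠ 0 := by linarith
  have hn : (Fintype.card V : ℝ) ≠ 0 := by exact_mod_cast Fintype.card_ne_zero
  have hvert : ∀ x : V, ∃ j a, x = φ j a := by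
    intro x
    have hx : x ∈ ⋃ j, (H j).verts := hcover ▸ Set.mem_univ x
    obtain ⟨j, hj⟩ := Set.mem_iUnion.mp hx
    obtain ⟨a, ha⟩ := (φ j).surjective ⟨x, hj⟩
    exact ⟨j, a, by rw [ha]⟩
  have hww : ∀ j (e : Sym2 (Bool ⊕ (Fin (r j) ⊕ Fin (s j)))),
      0 < whiskerWeight (r j) (s j) (v j) (u j) e ∧
        1 ≤ Fintype.card V * whiskerWeight (r j) (s j) (v j) (u j) e := by
    intro j e
    unfold whiskerWeight
    split_ifs
    exacts [⟨hu j, hu1 j⟩, ⟨hv j, hv1 j⟩]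
  have hedge : ∀ e : G.edgeSet, forestWeight φ v u e.1 = 0 ∨
      ∃ j a b, (whiskerGraph (r j) (s j)).Adj a b ∧ e.1 = s((φ j a : V), (φ j b : V)) := by
    rintro ⟨e, he⟩
    by_cases h : ∃ j, e ∈ (H j).edgeSet
    · obtain ⟨j, hj⟩ := h
      induction e using Sym2.ind with
      | _ x y =>
        obtain ⟨a, b, rfl, rfl, hab⟩ := exists_of_cluster_adj (φ := φ) (x := x) (y := y) hj
        exact Or.inr ⟨j, a, b, hab, rfl⟩
    · push Not at h
      exact Or.inl (forestWeight_eq_zero h)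
  have hnonneg : ∀ e : G.edgeSet, 0 ≤ forestWeight φ v u e.1 := by
    intro e
    rcases hedge e with h | ⟨j, a, b, hab, h⟩
    · exact h.ge
    · rw [h, forestWeight_cluster hdisj hab]
      exact (hww j _).1.le
  rw [graphLaw_eq_incLaw]
  refine isLinearlyStable_of_selProb_le hα hε0 hε (isEquilibrium_incLaw hnonneg (fun x => ?_)
    fun e => ?_) (fun e he => ?_) fun x => ?_
  · obtain ⟨j, a, rfl⟩ := hvert x
    rw [weightSum_forestWeight hdisj hα0]
    exact (whiskerSum_pos (hv j) (hu j) a).ne'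
  · rcases hedge e with h | ⟨j, a, b, hab, h⟩
    · have hz := selProb_eq_zero (inc := incidentEdges G)
        (v := fun e : G.edgeSet => forestWeight φ v u e.1) hα0 h
      rw [Finset.sum_eq_zero fun x _ => hz x, h, zero_div]
    · have h1 := sum_selProb_edge (α := α) (v := fun e : G.edgeSet => forestWeight φ v u e.1) h 1
      simp only [Pi.one_apply, mul_one] at h1
      rw [h1, weightSum_forestWeight hdisj hα0, weightSum_forestWeight hdisj hα0, h,
        forestWeight_cluster hdisj hab, eq_div_iff hn, mul_comm]
      exact whisker_balance (hv j) (hrs j) (hequ j) (heqv j) hab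
  · rcases hedge e with h | ⟨j, a, b, hab, h⟩
    · exact absurd h he
    · rw [h, forestWeight_cluster hdisj hab]
      exact (hww j _).2
  · obtain ⟨j, a, rfl⟩ := hvert x
    obtain ⟨b, hab, hb⟩ := whisker_dominant (hv j) (hu j) (hvu j) a
    have hadj : (H j).Adj (φ j a) (φ j b) := cluster_adj_iff.mpr hab
    refine ⟨⟨s((φ j a : V), (φ j b : V)), hadj.adj_sub⟩, by simp [mem_incidentEdges], ?_, ?_⟩
    · rw [forestWeight_cluster hdisj hab]
      exact (hww j _).1.ne'
    · intro f hf
      by_cases hmem : f ∈ incidentEdges G (φ j a : V)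
      · obtain ⟨w, hw⟩ := Sym2.mem_iff_exists.mp (mem_incidentEdges.mp hmem)
        by_cases hw' : (H j).Adj (φ j a) w
        · obtain ⟨-, b', -, rfl, -⟩ := exists_of_cluster_adj (φ := φ) hw'
          have hab' := cluster_adj_iff.mp hw'
          rw [selProb, if_pos hmem, weightSum_forestWeight hdisj hα0, hw,
            forestWeight_cluster hdisj hab']
          refine hb b' hab' fun h => hf (Subtype.ext ?_)
          rw [hw, h]
        · rw [selProb_eq_zero hα0 (by rw [hw, forestWeight_eq_zero_of_not_adj hdisj hw'])]
          exact hε0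
      · rw [selProb, if_neg hmem]
        exact hε0

/-- For large α the local solutions exist in every cluster and glue to an equilibrium with dominant
edges, which is stable and not merely critical. -/
theorem exists_stable_allocation {V : Type*} [Fintype V] [Nonempty V] {G : SimpleGraph V}
    {k : ℕ} {H : Fin k → G.Subgraph} (hcover : ⋃ j, (H j).verts = Set.univ)
    (hdisj : ∀ i j, i ≠ j → Disjoint (H i).verts (H j).verts)
    (hshape : ∀ j, IsStar (H j).coe ∨ IsSymmetricWhisker (H j).coe) :
    ∃ a : ℝ, 1 < a ∧ ∀ α : ℝ, a < α → ∃ v : G.edgeSet → ℝ,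
      (∀ e : G.edgeSet, (∃ j, (e : Sym2 V) ∈ (H j).edgeSet) → 0 < v e) ∧
      (∀ e : G.edgeSet, (¬ ∃ j, (e : Sym2 V) ∈ (H j).edgeSet) → v e = 0) ∧
      v ∈ stableEquilibria G α := by
  choose r s hrs hφ using fun j => exists_whiskerGraph_iso (hshape j)
  let φ := fun j => (hφ j).some
  have hlim : Tendsto (fun α : ℝ => (3 / 4 : ℝ) ^ α) atTop (𝓝 0) :=
    tendsto_rpow_atTop_of_base_lt_one _ (by norm_num) (by norm_num)
  -- The stability criterion carries a factor α, so exponential decay of the minor probabilities is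
  -- what is needed.
  have hlim1 : Tendsto (fun α : ℝ => α * (3 / 4 : ℝ) ^ α) atTop (𝓝 0) := by
    have hpos : 0 < -Real.log (3 / 4) := neg_pos.mpr (Real.log_neg (by norm_num) (by norm_num))
    refine (tendsto_rpow_mul_exp_neg_mul_atTop_nhds_zero 1 _ hpos).congr fun α => ?_
    rw [Real.rpow_one, Real.rpow_def_of_pos (by norm_num), neg_neg]
  have h1 : ∀ᶠ α : ℝ in atTop,
      4 * α * (3 / 4 : ℝ) ^ α * (Fintype.card V * Fintype.card G.edgeSet) < 1 := by
    have := hlim1.const_mul (4 * ((Fintype.card V : ℝ) * Fintype.card G.edgeSet))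
    rw [mul_zero] at this
    filter_upwards [this.eventually_lt_const one_pos] with α hα
    linarith
  have h2 : ∀ᶠ α : ℝ in atTop, ∀ j, (r j + 1) * (3 / 4 : ℝ) ^ α < 1 / 2 := by
    refine eventually_all.mpr fun j => ?_
    have := hlim.const_mul ((r j : ℝ) + 1)
    rw [mul_zero] at this
    exact this.eventually_lt_const (by norm_num)
  obtain ⟨a, ha⟩ := eventually_atTop.mp (h1.and h2)
  refine ⟨max a 2, lt_max_of_lt_right one_lt_two, fun α hα => ?_⟩
  obtain ⟨h3, h4⟩ := ha α ((le_max_left a 2).trans hα.le)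
  have hα1 : 1 < α := one_lt_two.trans ((le_max_right a 2).trans_lt hα)
  choose v u hv hu hv1 hu1 hvu hequ heqv using fun j =>
    exists_whisker_weights (n := Fintype.card V) (hrs j) hα1
      (by exact_mod_cast Fintype.card_pos) (h4 j)
  refine ⟨fun e => forestWeight φ v u e.1, ?_, ?_, ?_⟩
  · rintro ⟨e, he⟩ ⟨j, hj⟩
    induction e using Sym2.ind with
    | _ x y =>
      obtain ⟨a, b, rfl, rfl, hab⟩ := exists_of_cluster_adj (φ := φ) (x := x) (y := y) hj
      change 0 < forestWeight φ v u s(_, _)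
      rw [forestWeight_cluster hdisj hab]
      unfold whiskerWeight
      split_ifs
      exacts [hu j, hv j]
  · intro e he
    push Not at he
    exact forestWeight_eq_zero he
  · refine isLinearlyStable_forestWeight (ε := (3 / 4 : ℝ) ^ α) hα1 (by positivity) ?_ hcover hdisj hrs hv hu hv1 hu1
      (fun j => ?_) hequ heqv
    · convert h3
    · have := hv j
      have := hu j
      refine Real.rpow_le_rpow (by positivity) ?_ (by linarith)
      rw [div_le_iff₀ (hu j)]
      exact hvu j

theorem exists_stable_of_isSymmetricWhisker {V : Type*} [Fintype V] {G : SimpleGraph V}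
    (h : IsSymmetricWhisker G) :
    ∃ a : ℝ, 1 < a ∧ ∀ α : ℝ, a < α → (stableEquilibria G α).Nonempty := by
  obtain ⟨r, hr, ⟨f⟩⟩ := h
  have : Nonempty V := ⟨f (Sum.inl false)⟩
  -- The whole graph is taken as the only cluster.
  obtain ⟨a, ha, hst⟩ := exists_stable_allocation (G := G) (H := fun _ : Fin 1 => ⊤)
    (by simp [Set.iUnion_const]) (fun i j hij => absurd (Subsingleton.elim i j) hij)
    fun _ => Or.inr ⟨r, hr, ⟨f.trans SimpleGraph.Subgraph.topIso.symm⟩⟩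
  refine ⟨a, ha, fun α hα => ?_⟩
  obtain ⟨v, -, -, hv⟩ := hst α hα
  exact ⟨v, hv⟩

end Forest

end WARM

end

theorem theorem11 :
    (∀ r : ℕ, 1 ≤ r → ∃ a : ℝ, 1 < a ∧
      -- the explicit characterisation of the threshold `a = α(r)`
      WARM.thresholdFun a = Real.log ((1 + (r : ℝ)) / 2) ∧
      (∀ β : ℝ, 1 < β → WARM.thresholdFun β = Real.log ((1 + (r : ℝ)) / 2) → β = a) ∧
      (2 * (1 - 1 / a)) ^ (a - 1) = a / 2 * ((r : ℝ) + 1) ∧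
      -- above the threshold: two equilibria, of which exactly the first is linearly stable
      (∃ v u v' u' : ℝ → ℝ,
        (∀ α : ℝ, a < α →
          {q : ℝ × ℝ | 0 < q.2 ∧ WARM.whiskerVector r q.1 q.2 ∈
              WARM.equilibria (WARM.whiskerGraph r r) α} = {(v α, u α), (v' α, u' α)} ∧
          (v α, u α) ≠ (v' α, u' α) ∧
          v α < u α ∧ v' α < u' α ∧
          WARM.whiskerVector r (v α) (u α) ∈
            WARM.stableEquilibria (WARM.whiskerGraph r r) α ∧
          WARM.whiskerVector r (v' α) (u' α) ∉
            WARM.stableEquilibria (WARM.whiskerGraph r r) α) ∧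
        StrictMonoOn u (Set.Ioi a) ∧
        Tendsto u atTop (𝓝 (1 / ((r : ℝ) + 1)))) ∧
      -- below the threshold: none
      (∀ α : ℝ, 1 < α → α < a → ∀ v u : ℝ, 0 < u →
        WARM.whiskerVector r v u ∉ WARM.equilibria (WARM.whiskerGraph r r) α)) ∧
    -- every symmetric whisker graph has a linearly stable equilibrium for large exponents
    (∀ (V : Type*) [Fintype V] (G : SimpleGraph V), WARM.IsSymmetricWhisker G →
      ∃ a : ℝ, 1 < a ∧ ∀ α : ℝ, a < α → (WARM.stableEquilibria G α).Nonempty) ∧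
    -- every symmetric whisker-forest admits a stable allocation for large exponents
    (∀ (V : Type*) [Fintype V] [Nonempty V] (G : SimpleGraph V) (k : ℕ)
      (H : Fin k → G.Subgraph), WARM.IsSymmetricWhiskerForest G H →
      ∃ a : ℝ, 1 < a ∧ ∀ α : ℝ, a < α → WARM.AdmitsStableAllocation G α H) := by
  exact ⟨fun r hr => WARM.whisker_phase_transition hr,
    fun V _ G hG => WARM.exists_stable_of_isSymmetricWhisker hG,
    fun V _ _ G k H hH => by
      obtain ⟨⟨-, -, -, hcover, hdisj⟩, hshape⟩ := hH
      obtain ⟨a, ha, hst⟩ := WARM.exists_stable_allocation hcover hdisj hshape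
      refine ⟨a, ha, fun α hα => ?_⟩
      obtain ⟨v, hpos, hzero, hv⟩ := hst α hα
      exact ⟨v, hpos, hzero, Or.inl hv⟩⟩
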